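/- Let $k$ be a perfect field of characteristic $p>0$, $W=W(k)$ its ring of Witt vectors, $A$ a smooth $W$-algebra of finite type, and $L>M\ge 1$ integers. Write $A_n=A/p^nA$ and $\Omega^s=\Omega^s_{A/W}$ (zero for $s<0$). *The target.* For $N\in\{L,M\}$ and an integer $n$, let $\mathbf C_n(A_N)$ be the $W$-module of sums $\sum_{m\ge 0}\alpha_m\,\varepsilon(d\varepsilon)^{m}+\sum_{m\ge0}\beta_m(d\varepsilon)^m$ with $\alpha_m\in\Omega^{n-2m-1}$ and $\beta_m\in\Omega^{n-2m}$. Put $$\delta(\alpha\varepsilon(d\varepsilon)^{m})=p^N\alpha(d\varepsilon)^{m},\quad \delta(\beta(d\varepsilon)^m)=0,$$ $$B(\alpha\varepsilon(d\varepsilon)^{m})=-d\alpha\,\varepsilon(d\varepsilon)^{m}+\alpha(d\varepsilon)^{m+1},\quad B(\beta(d\varepsilon)^m)=d\beta\,(d\varepsilon)^m .$$ Let $\mathbf{CC}_n(A_N)=\bigoplus_{i\ge0}\mathbf C_{n-2i}(A_N)$, and let $\mathbf D:\mathbf{CC}_n(A_N)\to\mathbf{CC}_{n-1}(A_N)$ be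 $\delta+B$ followed by the projection that discards the component in $\mathbf C_{n+1}(A_N)$. The transition map $\omega\mapsto\overline{\omega}$, $\mathbf{CC}_n(A_L)\to\mathbf{CC}_n(A_M)$, multiplies $\alpha\varepsilon(d\varepsilon)^{m}$ by $p^{(L-M)(m+1)}$ and $\beta(d\varepsilon)^m$ by $p^{(L-M)m}$. Let $\mathbf{CC}(A_L,A_M)$ be the complex with $\mathbf{CC}_n(A_L)\oplus\mathbf{CC}_{n+1}(A_M)$ in homological degree $n$ (cohomological degree $-n$) and differential $(\omega,\upsilon)\mapsto(\mathbf D\omega,\overline{\omega}-\mathbf D\upsilon)$. Let $\mathbf{HC}_n(A_L,A_M)$ be its $n$-th homology. *The source.* For $r\ge0$ and $N\in\{L,M\}$ let $p^{r+1,N}\Omega^{\le r}_A$ be the complex $p^{(r+1)N}A\to p^{rN}\Omega^1\to\cdots\to p^{N}\Omega^r\to0$ with $A$ in degree $0$, and let $\mathrm{Cone}_r$ be the cone of the inclusion $p^{r+1,L}\Omega_A^{\le r}\to p^{r+1,M}\Omega_A^{\le r}$, whose differential is $(\theta,\lambda)\mapsto(-d\theta,\theta+d\lambda)$. (1) There is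 a unique morphism of complexes of $W$-modules $$\Psi:\bigoplus_{r\ge0}\mathrm{Cone}_r[2r]\longrightarrow\mathbf{CC}(A_L,A_M)$$ which on the $r$-th summand in cohomological degree $-n$, $n\ge r$, sends $(\theta,\lambda)=(p^{(n-r)L}\eta,\;p^{(n-r+1)M}\kappa)$ with $\eta\in\Omega^{2r-n+1}$, $\kappa\in\Omega^{2r-n}$ to $$\Big(\sum_{m=1}^{n-r}(-1)^{m-1}p^{(n-r-m)L}\eta\,\varepsilon(d\varepsilon)^{m-1}+\lambda,\ \sum_{m=1}^{n-r+1}(-1)^{m-1}p^{(n-r-m+1)M}\kappa\,\varepsilon(d\varepsilon)^{m-1}\Big)$$ (for $n=r$ one has $\theta=0$ and the first sum is empty; for $n<r$ the summand is zero). The morphism $\Psi$ is a quasi-isomorphism. (2) Consequently, for every $n\ge0$ there is an isomorphism of $W$-modules $$\mathbf{HC}_n(A_L,A_M)\cong\bigoplus_{s\in n-2\mathbb Z_{\ge0}}\frac{\{\omega\in p^{(\frac{n-s}2+1)M}\Omega^s\mid d\omega\in p^{\frac{n-s}2L}\Omega^{s+1}\}}{p^{(\frac{n-s}2+1)L}\Omega^s+d\big(p^{(\frac{n-s}2+2)M}\Omega^{s-1}\big)}$$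 under which the class of $\omega$ in the summand of index $s$ corresponds to the class of $\Psi(-d\omega,\omega)$, where $(-d\omega,\omega)$ is taken in $\mathrm{Cone}_r[2r]$ with $r=\frac{n+s}2$ (and $-d\omega$ is replaced by $0$ when $s=n=r$). (3) For every $n\ge0$ there is an isomorphism $$H_n\big(\mathbf{CC}(A_L,A_M)\otimes_{\mathbb Z}\mathbb Z/p\big)\cong\bigoplus_{s=0}^n\Omega^s_{A_1/k}$$ under which, for $\alpha=a\,db_1\wedge\dots\wedge db_s\in\Omega^s$ with $a,b_i\in A$ and $m\ge0$, the classes of $(\alpha\,\varepsilon(d\varepsilon)^m,0)$ (if $s=n-1-2m$) and $(0,\alpha\,\varepsilon(d\varepsilon)^m)$ (if $s=n-2m$) correspond to $\alpha\bmod p\in\Omega^s_{A_1/k}$. -/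

import Mathlib

open CategoryTheory DirectSum

/-- The algebra `Ω^•_{A/R}` of all differential forms: exterior algebra of Kähler differentials. -/
abbrev Forms (R : Type*) (A : Type*) [CommRing R] [CommRing A] [Algebra R A] :=
  ExteriorAlgebra A (Ω[A⁄R])

namespace Forms

section
variable (R : Type*) (A : Type*) [CommRing R] [CommRing A] [Algebra R A]

/-- `Da` as a one-form. -/
noncomputable def dOne (a : A) : Forms R A := ExteriorAlgebra.ι A (KaehlerDifferential.D R A a)

lemma dOne_mul (a b : A) : dOne R A (a * b) = a • dOne R A b + b • dOne R A a := by
  simp [dOne]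

lemma ι_anticomm (v w : Ω[A⁄R]) :
    (ExteriorAlgebra.ι A v : Forms R A) * ExteriorAlgebra.ι A w =
      -(ExteriorAlgebra.ι A w * ExteriorAlgebra.ι A v) :=
  eq_neg_of_add_eq_zero_left (ExteriorAlgebra.ι_add_mul_swap v w)

/-- The ring homomorphism `a ↦ [[a, da], [0, a]]`. -/
noncomputable def twist : A →ₐ[R] Matrix (Fin 2) (Fin 2) (Forms R A) where
  toFun a := !![algebraMap A _ a, dOne R A a; 0, algebraMap A _ a]
  map_one' := by
    ext i j; fin_cases i <;> fin_cases j <;> simp [dOne]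
  map_zero' := by
    ext i j; fin_cases i <;> fin_cases j <;> simp [dOne]
  map_mul' a b := by
    ext i j; fin_cases i <;> fin_cases j <;>
      simp [dOne_mul, Matrix.mul_apply, Fin.sum_univ_two, Algebra.smul_def,
        ← Algebra.commutes b (dOne R A a)]
  map_add' a b := by
    ext i j; fin_cases i <;> fin_cases j <;> simp [dOne]
  commutes' r := by
    ext i j; fin_cases i <;> fin_cases j <;> simp [dOne, Matrix.algebraMap_matrix_apply, ← IsScalarTower.algebraMap_apply]

lemma twist_apply (a : A) :
    twist R A a = !![algebraMap A _ a, dOne R A a; 0, algebraMap A _ a] := rfl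

/-- The centralizer of the image of `twist`; an algebra over `A` through `twist`. -/
def Tw : Type _ := ↥(Subalgebra.centralizer R (Set.range (twist R A)))

noncomputable instance : Ring (Tw R A) :=
  inferInstanceAs (Ring ↥(Subalgebra.centralizer R (Set.range (twist R A))))

noncomputable instance : Algebra R (Tw R A) :=
  inferInstanceAs (Algebra R ↥(Subalgebra.centralizer R (Set.range (twist R A))))

/-- The underlying matrix. -/
noncomputable def Tw.val : Tw R A →ₐ[R] Matrix (Fin 2) (Fin 2) (Forms R A) :=
  (Subalgebra.centralizer R (Set.range (twist R A))).val

lemma Tw.val_injective : Function.Injective (Tw.val R A) := Subtype.val_injective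

noncomputable instance : Algebra A (Tw R A) :=
  RingHom.toAlgebra'
    ((twist R A).codRestrict (Subalgebra.centralizer R (Set.range (twist R A))) (by
      rintro a _ ⟨b, rfl⟩
      rw [← map_mul, ← map_mul, mul_comm])).toRingHom
    (fun a x => Subtype.ext (x.2 _ ⟨a, rfl⟩))

lemma Tw.val_algebraMap (a : A) : Tw.val R A (algebraMap A (Tw R A) a) = twist R A a := rfl

lemma Tw.val_smul (a : A) (x : Tw R A) : Tw.val R A (a • x) = twist R A a * Tw.val R A x := by
  rw [Algebra.smul_def, map_mul, Tw.val_algebraMap]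

instance : IsScalarTower R A (Tw R A) := IsScalarTower.of_algebraMap_eq fun r => by
  apply Tw.val_injective
  rw [Tw.val_algebraMap, AlgHom.commutes, AlgHom.commutes]

lemma diag_mem (c : A) : !![-dOne R A c, 0; 0, dOne R A c] ∈
    Subalgebra.centralizer R (Set.range (twist R A)) := by
  rintro _ ⟨b, rfl⟩
  have h : dOne R A b * dOne R A c = -(dOne R A c * dOne R A b) :=
    ι_anticomm R A (KaehlerDifferential.D R A b) (KaehlerDifferential.D R A c)
  rw [twist_apply]
  ext i j
  fin_cases i <;> fin_cases j <;>
    simp [Matrix.mul_apply, Fin.sum_univ_two, Algebra.commutes, h]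

/-- `diag (-dc, dc)` as an element of `Tw R A`. -/
noncomputable def diag (c : A) : Tw R A := ⟨_, diag_mem R A c⟩

lemma Tw.val_diag (c : A) : Tw.val R A (diag R A c) = !![-dOne R A c, 0; 0, dOne R A c] := rfl

lemma diag_add (a b : A) : diag R A (a + b) = diag R A a + diag R A b := by
  apply Tw.val_injective
  rw [map_add]
  simp only [Tw.val_diag]
  ext i j
  fin_cases i <;> fin_cases j <;> simp [dOne, add_comm]

lemma diag_smul (r : R) (a : A) : diag R A (r • a) = r • diag R A a := by
  apply Tw.val_injective
  rw [map_smul]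
  simp only [Tw.val_diag]
  ext i j
  fin_cases i <;> fin_cases j <;> simp [dOne]

lemma diag_mul (a b : A) : diag R A (a * b) = a • diag R A b + b • diag R A a := by
  have h : dOne R A b * dOne R A a = -(dOne R A a * dOne R A b) :=
    ι_anticomm R A (KaehlerDifferential.D R A b) (KaehlerDifferential.D R A a)
  apply Tw.val_injective
  rw [map_add, Tw.val_smul, Tw.val_smul]
  simp only [Tw.val_diag, twist_apply, dOne_mul, Algebra.smul_def]
  ext i j
  fin_cases i <;> fin_cases j <;>
    simp [h, add_comm] <;> simp only [Algebra.smul_def]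

/-- `diag` as a linear map. -/
noncomputable def diagLin : A →ₗ[R] Tw R A where
  toFun := diag R A
  map_add' := diag_add R A
  map_smul' := diag_smul R A

/-- `c ↦ diag (-dc, dc)` is a derivation. -/
noncomputable def diagDer : Derivation R A (Tw R A) :=
  Derivation.mk' (diagLin R A) (diag_mul R A)

/-- `ω ↦ [[-ω, dω], [0, ω]]` on one-forms. -/
noncomputable def oneFormTw : Ω[A⁄R] →ₗ[A] Tw R A := (diagDer R A).liftKaehlerDifferential

lemma oneFormTw_D (c : A) : oneFormTw R A (KaehlerDifferential.D R A c) = diag R A c :=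
  (diagDer R A).liftKaehlerDifferential_comp_D c

lemma oneFormTw_spec (v : Ω[A⁄R]) : ∃ y : Forms R A,
    Tw.val R A (oneFormTw R A v) =
      !![-(ExteriorAlgebra.ι A v), y; 0, ExteriorAlgebra.ι A v] ∧
    y ∈ ⋀[A]^2 (Ω[A⁄R]) ∧
    ∀ w : Ω[A⁄R], y * ExteriorAlgebra.ι A w = ExteriorAlgebra.ι A w * y := by
  have hv : v ∈ Submodule.span A (Set.range (KaehlerDifferential.D R A)) := by
    rw [KaehlerDifferential.span_range_derivation]; trivial
  induction hv using Submodule.span_induction with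
  | mem x hx =>
    obtain ⟨c, rfl⟩ := hx
    refine ⟨0, ?_, zero_mem _, by simp⟩
    rw [oneFormTw_D, Tw.val_diag, dOne]
  | zero => exact ⟨0, by ext i j; fin_cases i <;> fin_cases j <;> simp, zero_mem _, by simp⟩
  | add a b _ _ ha hb =>
    obtain ⟨y, h1, h2, h3⟩ := ha
    obtain ⟨z, k1, k2, k3⟩ := hb
    refine ⟨y + z, ?_, add_mem h2 k2, fun w => by rw [add_mul, mul_add, h3, k3]⟩
    rw [map_add, map_add, h1, k1]
    ext i j; fin_cases i <;> fin_cases j <;> simp [add_comm]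
  | smul a b _ hb =>
    obtain ⟨y, h1, h2, h3⟩ := hb
    refine ⟨a • y + dOne R A a * ExteriorAlgebra.ι A b, ?_, ?_, fun w => ?_⟩
    · rw [map_smul, Tw.val_smul, h1]
      ext i j; fin_cases i <;> fin_cases j <;>
        simp [twist_apply, Matrix.mul_apply, Fin.sum_univ_two, Algebra.smul_def]
    · refine add_mem (Submodule.smul_mem _ _ h2) ?_
      rw [ExteriorAlgebra.exteriorPower, pow_two]
      exact Submodule.mul_mem_mul ⟨_, rfl⟩ ⟨_, rfl⟩
    · rw [add_mul, mul_add, smul_mul_assoc, h3, mul_smul_comm, dOne, mul_assoc,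
        ι_anticomm R A b w, mul_neg, ← mul_assoc, ι_anticomm R A _ w, neg_mul, neg_neg, mul_assoc]

/-- The algebra homomorphism `x ↦ [[(-1)^{deg x} x, dx], [0, x]]`. -/
noncomputable def formsTw : Forms R A →ₐ[A] Tw R A :=
  ExteriorAlgebra.lift A ⟨oneFormTw R A, fun v => by
    obtain ⟨y, h1, -, h3⟩ := oneFormTw_spec R A v
    apply Tw.val_injective
    rw [map_mul, h1, map_zero]
    ext i j; fin_cases i <;> fin_cases j <;>
      simp [Matrix.mul_apply, Fin.sum_univ_two, h3]⟩

/-- The exterior derivative on `Ω^•_{A/R}`. -/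
noncomputable def d : Forms R A →ₗ[R] Forms R A where
  toFun x := Tw.val R A (formsTw R A x) 0 1
  map_add' x y := by simp
  map_smul' r x := by
    rw [← algebraMap_smul A r x, map_smul, algebraMap_smul, map_smul, Matrix.smul_apply]
    rfl

lemma formsTw_ι (v : Ω[A⁄R]) : formsTw R A (ExteriorAlgebra.ι A v) = oneFormTw R A v :=
  ExteriorAlgebra.lift_ι_apply A _ _ v

/-- `(-1)^{deg}` -/
noncomputable abbrev invol : Forms R A →ₐ[A] Forms R A := CliffordAlgebra.involute

lemma invol_ι (v : Ω[A⁄R]) :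
    invol R A (ExteriorAlgebra.ι A v) = - ExteriorAlgebra.ι A v := CliffordAlgebra.involute_ι v

lemma val_formsTw (x : Forms R A) :
    Tw.val R A (formsTw R A x) = !![invol R A x, d R A x; 0, x] := by
  suffices h : Tw.val R A (formsTw R A x) 0 0 = invol R A x ∧
      Tw.val R A (formsTw R A x) 1 0 = 0 ∧ Tw.val R A (formsTw R A x) 1 1 = x by
    ext i j
    fin_cases i <;> fin_cases j
    · exact h.1
    · rfl
    · exact h.2.1
    · exact h.2.2
  induction x using ExteriorAlgebra.induction with
  | algebraMap r => simp [Tw.val_algebraMap, twist_apply]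
  | ι v =>
    obtain ⟨y, h1, -, -⟩ := oneFormTw_spec R A v
    rw [formsTw_ι, h1, invol_ι]
    simp
  | mul a b ha hb =>
    obtain ⟨ha1, ha2, ha3⟩ := ha
    obtain ⟨hb1, hb2, hb3⟩ := hb
    simp only [map_mul, Matrix.mul_apply, Fin.sum_univ_two, ha1, ha2, ha3, hb1, hb2, hb3]
    simp
  | add a b ha hb =>
    obtain ⟨ha1, ha2, ha3⟩ := ha
    obtain ⟨hb1, hb2, hb3⟩ := hb
    simp only [map_add, Matrix.add_apply, ha1, ha2, ha3, hb1, hb2, hb3]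
    simp

/-- `d` extends the universal derivation. -/
lemma d_algebraMap (a : A) :
    d R A (algebraMap A _ a) = ExteriorAlgebra.ι A (KaehlerDifferential.D R A a) := by
  change Tw.val R A (formsTw R A (algebraMap A _ a)) 0 1 = _
  rw [AlgHom.commutes, Tw.val_algebraMap]
  simp [twist_apply, dOne]

lemma d_ι_D (a : A) : d R A (ExteriorAlgebra.ι A (KaehlerDifferential.D R A a)) = 0 := by
  change Tw.val R A (formsTw R A _) 0 1 = _
  rw [formsTw_ι, oneFormTw_D, Tw.val_diag]
  simp

/-- The graded Leibniz rule. -/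
lemma d_mul (x y : Forms R A) : d R A (x * y) = d R A x * y + invol R A x * d R A y := by
  change Tw.val R A (formsTw R A (x * y)) 0 1 = _
  rw [map_mul, map_mul, val_formsTw, val_formsTw]
  simp [Matrix.mul_apply, Fin.sum_univ_two, add_comm]

lemma d_ι_mem (v : Ω[A⁄R]) : d R A (ExteriorAlgebra.ι A v) ∈ ⋀[A]^2 (Ω[A⁄R]) := by
  obtain ⟨y, h1, h2, -⟩ := oneFormTw_spec R A v
  change Tw.val R A (formsTw R A _) 0 1 ∈ _
  rw [formsTw_ι, h1]
  simpa using h2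

lemma d_invol (x : Forms R A) : d R A (invol R A x) = - invol R A (d R A x) := by
  induction x using ExteriorAlgebra.induction with
  | algebraMap r => rw [AlgHom.commutes, d_algebraMap, invol_ι, neg_neg]
  | ι v =>
    rw [invol_ι, map_neg]
    congr 1
    have h := d_ι_mem R A v
    rw [ExteriorAlgebra.exteriorPower, pow_two] at h
    refine Submodule.mul_induction_on h ?_ ?_
    · rintro _ ⟨a, rfl⟩ _ ⟨b, rfl⟩
      rw [map_mul, invol_ι, invol_ι, neg_mul_neg]
    · intro a b ha hb
      rw [map_add, ← ha, ← hb]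
  | mul a b ha hb =>
    rw [map_mul, d_mul, ha, hb, d_mul, map_add, map_mul, map_mul]
    simp only [neg_mul, mul_neg, neg_add]
  | add a b ha hb => rw [map_add, map_add, ha, hb, map_add, map_add, neg_add]

lemma d_d (x : Forms R A) : d R A (d R A x) = 0 := by
  induction x using ExteriorAlgebra.induction with
  | algebraMap r => rw [d_algebraMap, d_ι_D]
  | ι v =>
    have hv : v ∈ Submodule.span A (Set.range (KaehlerDifferential.D R A)) := by
      rw [KaehlerDifferential.span_range_derivation]; trivial
    induction hv using Submodule.span_induction with
    | mem x hx =>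
      obtain ⟨c, rfl⟩ := hx
      rw [d_ι_D, map_zero]
    | zero => simp
    | add a b _ _ ha hb => rw [map_add, map_add, map_add, ha, hb, add_zero]
    | smul a b _ hb =>
      rw [map_smul, Algebra.smul_def, d_mul, map_add, d_mul, d_mul, hb, d_invol, d_algebraMap,
        d_ι_D, invol_ι]
      simp
  | mul a b ha hb =>
    rw [d_mul, map_add, d_mul, d_mul, ha, hb, d_invol]
    simp
  | add a b ha hb => rw [map_add, map_add, ha, hb, add_zero]

lemma d_mem_pow (n : ℕ) (x : Forms R A) (hx : x ∈ ⋀[A]^n (Ω[A⁄R])) :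
    d R A x ∈ ⋀[A]^(n + 1) (Ω[A⁄R]) := by
  induction n generalizing x with
  | zero =>
    rw [ExteriorAlgebra.exteriorPower, pow_zero] at hx
    obtain ⟨a, rfl⟩ := Submodule.mem_one.mp hx
    rw [d_algebraMap, ExteriorAlgebra.exteriorPower, zero_add, pow_one]
    exact ⟨_, rfl⟩
  | succ n ih =>
    rw [ExteriorAlgebra.exteriorPower, pow_succ'] at hx
    refine Submodule.mul_induction_on hx ?_ ?_
    · rintro _ ⟨v, rfl⟩ y hy
      rw [d_mul, invol_ι]
      refine add_mem ?_ ?_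
      · rw [ExteriorAlgebra.exteriorPower, show n + 1 + 1 = 2 + n by omega, pow_add]
        exact Submodule.mul_mem_mul (d_ι_mem R A v) hy
      · rw [ExteriorAlgebra.exteriorPower, pow_succ', neg_mul]
        exact neg_mem (Submodule.mul_mem_mul ⟨_, rfl⟩ (ih y hy))
    · intro a b ha hb
      rw [map_add]
      exact add_mem ha hb

end
end Forms

namespace RelCyclic

section Forms
variable (R : Type*) (A : Type*) [CommRing R] [CommRing A] [Algebra R A]

/-- `Ω^s_{A/R}` for an integer `s`, as a subgroup of all forms; zero for `s < 0`. -/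
noncomputable def Om (s : ℤ) : Submodule R (Forms R A) :=
  if 0 ≤ s then (⋀[A]^s.toNat (Ω[A⁄R])).restrictScalars R else ⊥

lemma d_mem_Om {s t : ℤ} (h : s + 1 = t) {x : Forms R A} (hx : x ∈ Om R A s) :
    Forms.d R A x ∈ Om R A t := by
  subst h
  unfold Om at hx ⊢
  split_ifs at hx with hs
  · rw [if_pos (by omega), show (s + 1).toNat = s.toNat + 1 by omega]
    exact Forms.d_mem_pow R A _ x hx
  · rw [(Submodule.mem_bot R).mp hx, map_zero]
    exact zero_mem _

/-- `p^N Ω^s_{A/R}`. -/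
noncomputable def pOm (p N : ℕ) (s : ℤ) : Submodule R (Forms R A) :=
  (Om R A s).map ((p : R) ^ N • LinearMap.id)

lemma mem_pOm {p N : ℕ} {s : ℤ} {x : Forms R A} :
    x ∈ pOm R A p N s ↔ ∃ y ∈ Om R A s, (p : R) ^ N • y = x := Iff.rfl

lemma pOm_anti (p : ℕ) {N N' : ℕ} (h : N ≤ N') (s : ℤ) : pOm R A p N' s ≤ pOm R A p N s := by
  rintro _ ⟨y, hy, rfl⟩
  refine ⟨(p : R) ^ (N' - N) • y, Submodule.smul_mem _ _ hy, ?_⟩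
  simp only [LinearMap.smul_apply, LinearMap.id_coe, id_eq, smul_smul, ← pow_add]
  rw [Nat.add_sub_of_le h]

lemma d_mem_pOm (p N : ℕ) {s t : ℤ} (h : s + 1 = t) {x : Forms R A} (hx : x ∈ pOm R A p N s) :
    Forms.d R A x ∈ pOm R A p N t := by
  obtain ⟨y, hy, rfl⟩ := hx
  refine ⟨Forms.d R A y, d_mem_Om R A h hy, ?_⟩
  simp

/-! ### The source -/

/-- The term of degree `s` of the complex `p^{r+1,c} Ω^{≤ r}`, which is
`p^{(r+1)c} A → p^{rc} Ω^1 → ⋯ → p^c Ω^r → 0 → ⋯`. -/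
noncomputable def fil (p r c : ℕ) (s : ℤ) : Submodule R (Forms R A) :=
  if s ≤ r then pOm R A p (((r : ℤ) + 1 - s).toNat * c) s else ⊥

/-- The differential in degree `s` of the complexes `p^{r+1,c} Ω^{≤ r}`: the exterior derivative
for `s < r`, and zero from degree `r` on. -/
noncomputable def dTr (r : ℕ) (s : ℤ) : Forms R A →ₗ[R] Forms R A :=
  if s < r then Forms.d R A else 0

lemma dTr_mem_fil (p r c : ℕ) {s t : ℤ} (h : s + 1 = t) {x : Forms R A}
    (hx : x ∈ fil R A p r c s) : dTr R A r s x ∈ fil R A p r c t := by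
  unfold dTr
  split_ifs with hs
  · unfold fil at hx ⊢
    rw [if_pos (by omega)] at hx ⊢
    refine pOm_anti R A p (Nat.mul_le_mul_right c (by omega)) _ (d_mem_pOm R A p _ h hx)
  · exact zero_mem _

lemma fil_anti (p r : ℕ) {c c' : ℕ} (h : c ≤ c') (s : ℤ) :
    fil R A p r c' s ≤ fil R A p r c s := by
  unfold fil
  split_ifs
  · exact pOm_anti R A p (Nat.mul_le_mul_left _ h) s
  · exact le_rfl

lemma dTr_dTr (r : ℕ) (s t : ℤ) (x : Forms R A) : dTr R A r t (dTr R A r s x) = 0 := by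
  unfold dTr
  split_ifs <;> simp [Forms.d_d]

/-- The term of degree `s` of the cone of the inclusion
`p^{r+1,L} Ω^{≤ r} ⊆ p^{r+1,M} Ω^{≤ r}`. -/
abbrev ConeX (p L M r : ℕ) (s : ℤ) : Type _ :=
  ↥(fil R A p r L (s + 1)) × ↥(fil R A p r M s)

/-- The differential `(θ, λ) ↦ (-dθ, θ + dλ)` of the cone. -/
noncomputable def coneD (p : ℕ) {L M : ℕ} (hML : M < L) (r : ℕ) (s t : ℤ) (h : s + 1 = t) :
    ConeX R A p L M r s →ₗ[R] ConeX R A p L M r t where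
  toFun c :=
    (⟨-dTr R A r (s + 1) c.1, neg_mem (dTr_mem_fil R A p r L (by omega) c.1.2)⟩,
     ⟨c.1 + dTr R A r s c.2, add_mem (fil_anti R A p r hML.le _ (by subst h; exact c.1.2))
        (dTr_mem_fil R A p r M h c.2.2)⟩)
  map_add' x y := by
    ext
    · simp [add_comm]
    · simp only [Prod.fst_add, Prod.snd_add, Submodule.coe_add, map_add]; abel
  map_smul' a x := by
    ext
    · simp
    · simp

lemma coneD_coneD (p : ℕ) {L M : ℕ} (hML : M < L) (r : ℕ) (s t u : ℤ) (h : s + 1 = t) (h' : t + 1 = u)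
    (c : ConeX R A p L M r s) : coneD R A p hML r t u h' (coneD R A p hML r s t h c) = 0 := by
  subst h
  ext
  · simp [coneD, dTr_dTr]
  · simp [coneD, dTr_dTr]

/-- The complex `⨁_{r ≥ 0} Cone(p^{r+1,L} Ω^{≤ r} → p^{r+1,M} Ω^{≤ r})[2r]`
(the even shift does not change the sign of the differential). -/
noncomputable def source (p : ℕ) {L M : ℕ} (hML : M < L) : CochainComplex (ModuleCat R) ℤ where
  X i := ModuleCat.of R (⨁ r : ℕ, ConeX R A p L M r (i + 2 * r))
  d i j := if h : i + 1 = j then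
      ModuleCat.ofHom (DirectSum.lmap fun r => coneD R A p hML r _ _ (by omega))
    else 0
  shape i j h := dif_neg h
  d_comp_d' i j k hij hjk := by
    have hij' : i + 1 = j := hij
    have hjk' : j + 1 = k := hjk
    rw [dif_pos hij', dif_pos hjk', ← ModuleCat.ofHom_comp]
    ext : 1
    refine DirectSum.linearMap_ext _ fun r => LinearMap.ext fun c => ?_
    simp [DirectSum.lmap_lof, coneD_coneD]

/-! ### The target -/

/-- Forms in `ε, dε`: the pair `(a, b)` stands for `∑ₘ aₘ ε (dε)^m + ∑ₘ bₘ (dε)^m`. -/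
abbrev EForms : Type _ := (ℕ → Forms R A) × (ℕ → Forms R A)

/-- `𝐂_n(A/ℓ)`: the part of total degree `n`, where `α ε^j (dε)^m` with `α ∈ Ω^i` has total degree
`i + j + 2m`. -/
noncomputable def C (n : ℤ) : Submodule R (EForms R A) where
  carrier := {x | ∀ m : ℕ, x.1 m ∈ Om R A (n - 2 * m - 1) ∧ x.2 m ∈ Om R A (n - 2 * m)}
  add_mem' hx hy m := ⟨add_mem (hx m).1 (hy m).1, add_mem (hx m).2 (hy m).2⟩
  zero_mem' _ := ⟨zero_mem _, zero_mem _⟩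
  smul_mem' a _ hx m := ⟨Submodule.smul_mem _ a (hx m).1, Submodule.smul_mem _ a (hx m).2⟩

/-- `δ (α ε (dε)^m) = ℓ α (dε)^m` and `δ (β (dε)^m) = 0`. -/
noncomputable def δ (l : R) : EForms R A →ₗ[R] EForms R A where
  toFun x := (0, fun m => l • x.1 m)
  map_add' x y := by ext <;> simp
  map_smul' a x := by ext <;> simp [smul_comm l a]

/-- `B (α ε (dε)^m) = -dα ε (dε)^m + α (dε)^{m+1}` and `B (β (dε)^m) = dβ (dε)^m`. -/
noncomputable def B : EForms R A →ₗ[R] EForms R A where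
  toFun x := (fun m => -Forms.d R A (x.1 m),
    fun m => Forms.d R A (x.2 m) + (match m with | 0 => 0 | m + 1 => x.1 m))
  map_add' x y := by
    ext m
    · simp [add_comm]
    · cases m <;> simp [add_add_add_comm]
  map_smul' a x := by
    ext m
    · simp
    · cases m <;> simp

/-- The transition map `𝐂_n(A_L) → 𝐂_n(A_M)`, with `e = L - M`:
`α ε (dε)^m ↦ p^{e(m+1)} α ε (dε)^m` and `β (dε)^m ↦ p^{em} β (dε)^m`. -/
noncomputable def transE (p e : ℕ) : EForms R A →ₗ[R] EForms R A where
  toFun x := (fun m => (p : R) ^ (e * (m + 1)) • x.1 m, fun m => (p : R) ^ (e * m) • x.2 m)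
  map_add' x y := by ext <;> simp
  map_smul' a x := by ext <;> simp [smul_comm _ a]

variable {R A}

lemma δ_mem (l : R) {n n' : ℤ} (h : n' + 1 = n) {x : EForms R A} (hx : x ∈ C R A n) :
    δ R A l x ∈ C R A n' := fun m => by
  refine ⟨zero_mem _, ?_⟩
  have := (hx m).1
  rw [show n - 2 * (m : ℤ) - 1 = n' - 2 * m by omega] at this
  exact Submodule.smul_mem _ l this

lemma B_mem {n n' : ℤ} (h : n + 1 = n') {x : EForms R A} (hx : x ∈ C R A n) :
    B R A x ∈ C R A n' := fun m => by
  refine ⟨neg_mem (d_mem_Om R A (by omega) (hx m).1), ?_⟩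
  refine add_mem (d_mem_Om R A (by omega) (hx m).2) ?_
  cases m with
  | zero => exact zero_mem _
  | succ m =>
    have := (hx m).1
    rwa [show n - 2 * (m : ℤ) - 1 = n' - 2 * ((m + 1 : ℕ) : ℤ) by push_cast; omega] at this

lemma trans_mem (p e : ℕ) {n : ℤ} {x : EForms R A} (hx : x ∈ C R A n) :
    transE R A p e x ∈ C R A n := fun m =>
  ⟨Submodule.smul_mem _ _ (hx m).1, Submodule.smul_mem _ _ (hx m).2⟩

lemma δ_δ (l : R) (x : EForms R A) : δ R A l (δ R A l x) = 0 := by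
  ext <;> simp [δ]

lemma B_B (x : EForms R A) : B R A (B R A x) = 0 := by
  ext m
  · simp [B, Forms.d_d]
  · cases m <;> simp [B, Forms.d_d]

lemma δ_B (l : R) (x : EForms R A) : δ R A l (B R A x) + B R A (δ R A l x) = 0 := by
  ext m
  · simp [B, δ]
  · cases m <;> simp [B, δ]

lemma trans_δ (p : ℕ) {L M : ℕ} (h : M < L) (x : EForms R A) :
    transE R A p (L - M) (δ R A ((p : R) ^ L) x) =
      δ R A ((p : R) ^ M) (transE R A p (L - M) x) := by
  obtain ⟨e, rfl⟩ := Nat.exists_eq_add_of_le h.le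
  ext m
  · simp [transE, δ]
  · simp only [transE, δ, LinearMap.coe_mk, AddHom.coe_mk, smul_smul, ← pow_add]
    congr 2
    rw [Nat.add_sub_cancel_left]
    ring

lemma trans_B (p e : ℕ) (x : EForms R A) :
    transE R A p e (B R A x) = B R A (transE R A p e x) := by
  ext m
  · simp [transE, B]
  · cases m <;> simp [transE, B]

variable (R A)

/-- `𝐂𝐂_n(A/ℓ) = 𝐂_n ⊕ 𝐂_{n-2} ⊕ 𝐂_{n-4} ⊕ ⋯`: families `(xᵢ)` with `xᵢ ∈ 𝐂_{n-2i}`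
(the terms with `2i > n` vanish). -/
noncomputable def CC (n : ℤ) : Submodule R (ℕ → EForms R A) where
  carrier := {x | ∀ i : ℕ, x i ∈ C R A (n - 2 * i)}
  add_mem' hx hy i := add_mem (hx i) (hy i)
  zero_mem' _ := zero_mem _
  smul_mem' a _ hx i := Submodule.smul_mem _ a (hx i)

/-- `𝐃 = proj ∘ (δ + B) : 𝐂𝐂_n → 𝐂𝐂_{n-1}`. Its component in `𝐂_{n-1-2i}` is `δ xᵢ + B xᵢ₊₁`;
the projection discards `B x₀ ∈ 𝐂_{n+1}`. -/
noncomputable def DD (l : R) : (ℕ → EForms R A) →ₗ[R] (ℕ → EForms R A) where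
  toFun x i := δ R A l (x i) + B R A (x (i + 1))
  map_add' x y := by ext1 i; simp [add_add_add_comm]
  map_smul' a x := by ext1 i; simp

/-- The transition map `𝐂𝐂_n(A_L) → 𝐂𝐂_n(A_M)`, componentwise. -/
noncomputable def transCC (p e : ℕ) : (ℕ → EForms R A) →ₗ[R] (ℕ → EForms R A) where
  toFun x i := transE R A p e (x i)
  map_add' x y := by ext1 i; simp
  map_smul' a x := by ext1 i; simp

variable {R A}

lemma DD_mem (l : R) {n n' : ℤ} (h : n' + 1 = n) {x : ℕ → EForms R A} (hx : x ∈ CC R A n) :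
    DD R A l x ∈ CC R A n' := fun i =>
  add_mem (δ_mem l (by omega) (hx i)) (B_mem (by push_cast; omega) (hx (i + 1)))

lemma transCC_mem (p e : ℕ) {n : ℤ} {x : ℕ → EForms R A} (hx : x ∈ CC R A n) :
    transCC R A p e x ∈ CC R A n := fun i => trans_mem p e (hx i)

lemma DD_DD (l : R) (x : ℕ → EForms R A) : DD R A l (DD R A l x) = 0 := by
  ext1 i
  change δ R A l (δ R A l (x i) + B R A (x (i + 1))) +
    B R A (δ R A l (x (i + 1)) + B R A (x (i + 1 + 1))) = 0
  rw [map_add, map_add, δ_δ, B_B, zero_add, add_zero, δ_B]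

lemma transCC_DD (p : ℕ) {L M : ℕ} (h : M < L) (x : ℕ → EForms R A) :
    transCC R A p (L - M) (DD R A ((p : R) ^ L) x) =
      DD R A ((p : R) ^ M) (transCC R A p (L - M) x) := by
  ext1 i
  change transE R A p (L - M) (_ + _) = _ + _
  rw [map_add, trans_δ p h, trans_B]
  rfl

variable (R A)

/-- The term of degree `n` of the total complex: `𝐂𝐂_n(A_L) ⊕ 𝐂𝐂_{n+1}(A_M)`. -/
abbrev TotX (n : ℤ) : Type _ := ↥(CC R A n) × ↥(CC R A (n + 1))

/-- The differential `(ω, υ) ↦ (𝐃 ω, ω̄ - 𝐃 υ)` of the total complex, where `ω̄` is the image of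
`ω` under the transition map. -/
noncomputable def totD (p L M : ℕ) (n n' : ℤ) (h : n' + 1 = n) :
    TotX R A n →ₗ[R] TotX R A n' where
  toFun x :=
    (⟨DD R A ((p : R) ^ L) x.1, DD_mem _ h x.1.2⟩,
     ⟨transCC R A p (L - M) x.1 - DD R A ((p : R) ^ M) x.2,
        sub_mem (by subst h; exact transCC_mem p (L - M) x.1.2) (DD_mem _ (by omega) x.2.2)⟩)
  map_add' x y := by
    ext1
    · exact Subtype.ext (by simp)
    · exact Subtype.ext (by simp [add_sub_add_comm])
  map_smul' a x := by
    ext1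
    · exact Subtype.ext (by simp)
    · exact Subtype.ext (by simp [smul_sub])

lemma totD_totD (p : ℕ) {L M : ℕ} (hML : M < L) (n n' n'' : ℤ) (h : n' + 1 = n)
    (h' : n'' + 1 = n') (x : TotX R A n) :
    totD R A p L M n' n'' h' (totD R A p L M n n' h x) = 0 := by
  ext1
  · exact Subtype.ext (DD_DD _ _)
  · refine Subtype.ext ?_
    change transCC R A p (L - M) (DD R A ((p : R) ^ L) x.1) -
      DD R A ((p : R) ^ M) (transCC R A p (L - M) x.1 - DD R A ((p : R) ^ M) x.2) = 0
    rw [map_sub, DD_DD, sub_zero, transCC_DD p hML, sub_self]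

/-- The complex `𝐂𝐂(A_L, A_M)`, the total complex of the transition map
`𝐂𝐂(A_L) → 𝐂𝐂(A_M)`; homological degree `n` is placed in cohomological degree `-n`. -/
noncomputable def relCC (p : ℕ) {L M : ℕ} (hML : M < L) : CochainComplex (ModuleCat R) ℤ where
  X i := ModuleCat.of R (TotX R A (-i))
  d i j := if h : i + 1 = j then
      ModuleCat.ofHom (totD R A p L M (-i) (-j) (by omega))
    else 0
  shape i j h := dif_neg h
  d_comp_d' i j k hij hjk := by
    have hij' : i + 1 = j := hij
    have hjk' : j + 1 = k := hjk
    rw [dif_pos hij', dif_pos hjk', ← ModuleCat.ofHom_comp]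
    ext : 1
    exact LinearMap.ext fun c => totD_totD R A p hML _ _ _ (by omega) (by omega) c

/-- `𝐇𝐂_n(A_L, A_M)`. -/
noncomputable abbrev HC (p : ℕ) {L M : ℕ} (hML : M < L) (n : ℕ) : ModuleCat R :=
  (relCC R A p hML).homology (-(n : ℤ))

/-! ### The map -/

/-- `α ε (dε)^m`, placed in the summand `𝐂_{n-2i}` of `𝐂𝐂_n`. -/
noncomputable def epsTerm (i m : ℕ) (α : Forms R A) : ℕ → EForms R A :=
  Pi.single i (Pi.single m α, 0)

/-- `β (dε)^m`, placed in the summand `𝐂_{n-2i}` of `𝐂𝐂_n`. -/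
noncomputable def plainTerm (i m : ℕ) (β : Forms R A) : ℕ → EForms R A :=
  Pi.single i (0, Pi.single m β)

/-- For `q = n - r`, `η ∈ Ω^{2r-n+1}` and `lam ∈ Ω^{2r-n}`, the element
`∑_{m=1}^{q} (-1)^{m-1} p^{(q-m)L} η ε (dε)^{m-1} + lam` of `𝐂𝐂_n(A_L)`. Here `η ε (dε)^{m-1}` has
total degree `n - 2(q-m)` and `lam` has total degree `n - 2q`. -/
noncomputable def psiFst (p L q : ℕ) (η lam : Forms R A) : ℕ → EForms R A :=
  ∑ m ∈ Finset.Icc 1 q,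
    ((-1 : R) ^ (m - 1) * (p : R) ^ ((q - m) * L)) • epsTerm R A (q - m) (m - 1) η +
  plainTerm R A q 0 lam

/-- For `q = n - r` and `κ ∈ Ω^{2r-n}`, the element
`∑_{m=1}^{q+1} (-1)^{m-1} p^{(q+1-m)M} κ ε (dε)^{m-1}` of `𝐂𝐂_{n+1}(A_M)`. Here `κ ε (dε)^{m-1}`
has total degree `n + 1 - 2(q+1-m)`. -/
noncomputable def psiSnd (p M q : ℕ) (κ : Forms R A) : ℕ → EForms R A :=
  ∑ m ∈ Finset.Icc 1 (q + 1),
    ((-1 : R) ^ (m - 1) * (p : R) ^ ((q + 1 - m) * M)) • epsTerm R A (q + 1 - m) (m - 1) κ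

variable {R A}

/-- The element of the source in degree `i` given by an element of the `r`-th cone. -/
noncomputable def inCone {p L M : ℕ} (hML : M < L) (r : ℕ) (i : ℤ)
    (c : ConeX R A p L M r (i + 2 * r)) : (source R A p hML).X i :=
  DirectSum.lof R ℕ (fun r : ℕ => ConeX R A p L M r (i + 2 * r)) r c

/-- The underlying families of the two components of an element of `𝐂𝐂(A_L, A_M)`. -/
def toPair {p L M : ℕ} {hML : M < L} {i : ℤ} (z : (relCC R A p hML).X i) :
    (ℕ → EForms R A) × (ℕ → EForms R A) :=
  let w : TotX R A (-i) := z
  (w.1.1, w.2.1)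

/-- `Ψ` is given by the formula
`Ψ_r (p^{(n-r)L} η, p^{(n-r+1)M} κ) =`
`(∑_{m=1}^{n-r} (-1)^{m-1} p^{(n-r-m)L} η ε (dε)^{m-1} + p^{(n-r+1)M} κ,`
`∑_{m=1}^{n-r+1} (-1)^{m-1} p^{(n-r-m+1)M} κ ε (dε)^{m-1})`
on the `r`-th summand in homological degree `n`, where `n = r + q`; for `n < r` that summand is
zero. -/
def IsPsi {p L M : ℕ} {hML : M < L} (Ψ : source R A p hML ⟶ relCC R A p hML) : Prop :=
  ∀ (r q : ℕ) (c : ConeX R A p L M r (-((r + q : ℕ) : ℤ) + 2 * r)),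
    ∀ η ∈ Om R A ((r : ℤ) - q + 1), ∀ κ ∈ Om R A ((r : ℤ) - q),
      (c.1 : Forms R A) = (p : R) ^ (q * L) • η →
      (c.2 : Forms R A) = (p : R) ^ ((q + 1) * M) • κ →
      toPair (Ψ.f _ (inCone hML r _ c)) =
        (psiFst R A p L q η ((p : R) ^ ((q + 1) * M) • κ), psiSnd R A p M q κ)

/-- `h` is the class of the cocycle `z`. -/
def Represents {K : CochainComplex (ModuleCat R) ℤ} {i : ℤ} (z : K.X i) (h : K.homology i) :
    Prop :=
  ∃ c : K.cycles i, K.iCycles i c = z ∧ K.homologyπ i c = h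

variable (R A)

/-! ### The summands of the homology -/

/-- `{ω ∈ p^{(j+1)M} Ω^s | dω ∈ p^{jL} Ω^{s+1}}` with `s = n - 2j`. -/
noncomputable def hcNum (p L M n j : ℕ) : Submodule R (Forms R A) :=
  pOm R A p ((j + 1) * M) ((n : ℤ) - 2 * j) ⊓
    (pOm R A p (j * L) ((n : ℤ) - 2 * j + 1)).comap (Forms.d R A)

/-- `p^{(j+1)L} Ω^s + d(p^{(j+2)M} Ω^{s-1})` with `s = n - 2j`. -/
noncomputable def hcDen (p L M n j : ℕ) : Submodule R (Forms R A) :=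
  pOm R A p ((j + 1) * L) ((n : ℤ) - 2 * j) ⊔
    (pOm R A p ((j + 2) * M) ((n : ℤ) - 2 * j - 1)).map (Forms.d R A)

lemma hcDen_le_hcNum (p : ℕ) {L M : ℕ} (hML : M < L) (n j : ℕ) :
    hcDen R A p L M n j ≤ hcNum R A p L M n j := by
  refine sup_le (fun x hx => ⟨?_, ?_⟩) ?_
  · exact pOm_anti R A p (Nat.mul_le_mul_left _ hML.le) _ hx
  · exact pOm_anti R A p (Nat.mul_le_mul_right _ (Nat.le_succ j)) _ (d_mem_pOm R A p _ rfl hx)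
  · rintro _ ⟨x, hx, rfl⟩
    refine ⟨pOm_anti R A p (Nat.mul_le_mul_right M (Nat.le_succ (j + 1))) _
      (d_mem_pOm R A p _ (by omega) hx), ?_⟩
    change Forms.d R A (Forms.d R A x) ∈ pOm R A p (j * L) ((n : ℤ) - 2 * j + 1)
    rw [Forms.d_d]
    exact zero_mem _

/-- The summand of `𝐇𝐂_n(A_L, A_M)` with index `s = n - 2j`. -/
abbrev HCSummand (p L M n j : ℕ) : Type _ :=
  ↥(hcNum R A p L M n j) ⧸ (hcDen R A p L M n j).submoduleOf (hcNum R A p L M n j)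

end Forms

/-! ### Reduction modulo `p` -/

/-- `K ⊗_ℤ ℤ/p`, that is `K / p K` in each degree. -/
noncomputable def modP {R : Type*} [CommRing R] (p : ℕ) (K : CochainComplex (ModuleCat R) ℤ) :
    CochainComplex (ModuleCat R) ℤ where
  X i := ModuleCat.of R (K.X i ⧸ LinearMap.range ((p : R) • (LinearMap.id : K.X i →ₗ[R] K.X i)))
  d i j := ModuleCat.ofHom (Submodule.mapQ _ _ (K.d i j).hom (by
    rintro _ ⟨x, rfl⟩
    exact ⟨(K.d i j).hom x, by simp⟩))
  shape i j h := by
    ext : 1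
    refine Submodule.linearMap_qext _ (LinearMap.ext fun x => ?_)
    have h0 : (K.d i j).hom x = 0 := by rw [K.shape i j h]; rfl
    simp only [LinearMap.comp_apply, Submodule.mkQ_apply, ModuleCat.hom_ofHom,
      Submodule.mapQ_apply]
    rw [h0]
    exact (Submodule.Quotient.mk_eq_zero _).mpr (zero_mem _)
  d_comp_d' i j k _ _ := by
    rw [← ModuleCat.ofHom_comp]
    ext : 1
    refine Submodule.linearMap_qext _ (LinearMap.ext fun x => ?_)
    have h := congrArg (fun f => f.hom x) (K.d_comp_d i j k)
    simp only [ModuleCat.hom_comp, LinearMap.comp_apply] at h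
    simp [h]

/-- The class modulo `p` of an element of degree `i`. -/
noncomputable def toModP {R : Type*} [CommRing R] (p : ℕ) {K : CochainComplex (ModuleCat R) ℤ}
    {i : ℤ} (z : K.X i) : (modP p K).X i :=
  (LinearMap.range ((p : R) • (LinearMap.id : K.X i →ₗ[R] K.X i))).mkQ z

/-- `A_1 = A / p A`. -/
def SpecialFibre (p : ℕ) (A : Type*) [CommRing A] : Type _ := A ⧸ Ideal.span {(p : A)}

section SpecialFibre
variable (p : ℕ) (A : Type*) [CommRing A]

noncomputable instance : CommRing (SpecialFibre p A) :=
  inferInstanceAs (CommRing (A ⧸ Ideal.span {(p : A)}))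

/-- The projection `A → A_1`. -/
noncomputable def toFibre : A →+* SpecialFibre p A := Ideal.Quotient.mk _

variable [Fact p.Prime] (k : Type*) [Field k] [CharP k p] [PerfectRing k p]
  [Algebra (WittVector p k) A]

/-- The ring homomorphism `k = W(k)/p → A/p = A_1`. -/
noncomputable def fibreMap : k →+* SpecialFibre p A :=
  (Ideal.Quotient.lift (Ideal.span {(p : WittVector p k)})
    ((toFibre p A).comp (algebraMap (WittVector p k) A)) (by
      intro a ha
      obtain ⟨b, rfl⟩ := Ideal.mem_span_singleton'.mp ha
      rw [RingHom.comp_apply, map_mul, map_natCast]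
      exact Ideal.Quotient.eq_zero_iff_mem.mpr
        (Ideal.mul_mem_left _ _ (Ideal.mem_span_singleton_self _)))).comp
  (WittVector.quotientPEquiv (p := p) (k := k)).symm.toRingHom

/-- The structure of a `k`-algebra on `A_1`. -/
noncomputable instance : Algebra k (SpecialFibre p A) := (fibreMap p A k).toAlgebra

lemma fibreMap_constantCoeff (w : WittVector p k) :
    algebraMap k (SpecialFibre p A) (WittVector.constantCoeff w) =
      toFibre p A (algebraMap (WittVector p k) A w) := by
  have h : (WittVector.quotientPEquiv (p := p) (k := k)).symm (WittVector.constantCoeff w) =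
      Ideal.Quotient.mk _ w := by
    rw [RingEquiv.symm_apply_eq]
    exact (WittVector.quotientPEquiv_mk w).symm
  change fibreMap p A k (WittVector.constantCoeff w) = _
  rw [fibreMap, RingHom.comp_apply, RingEquiv.toRingHom_eq_coe, RingEquiv.coe_toRingHom, h]
  rfl

end SpecialFibre

end RelCyclic

open RelCyclic

/-! Write an element of the source in homological degree `n` by dividing out the prescribed powers
of `p`: the cone of index `r = n - q` contributes `η_q ∈ Ω^{n-2q+1}` (for `q ≥ 1`) and `κ_q ∈
Ω^{n-2q}`. These are exactly the coordinates of an element of `𝐂_n`. So the source becomes a complex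
`coordCx` on the modules `𝐂_n`, whose differential `coordD` involves only `d` and powers of `p`. The
passage from coordinates to cones is always surjective. It is injective because forms have no
`p`-torsion: `A` is flat over `W(k)` and `Ω^1` is projective. This is the only use of smoothness
(`forms_torsionFree`, `coordSourceLin_injective`, `isIso_coordSource`).

In coordinates `Ψ` is given by formulas that make sense over any base ring, and there it is a
quasi-isomorphism for an elementary reason. The operator `B` contains the term `α ε(dε)^m ↦ α
(dε)^{m+1}` with coefficient `1`, and the transition map is the identity on the terms `β (dε)^0`.
Inverting these unit entries shows that every element of the target is uniquely `Ψ(x) + k + 𝐝k'`,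
with `k` and `k'` in an explicit submodule `Compl` and `𝐝` the differential of the target
(`compl_exists`, `compl_unique`). Hence the target is the image of `Ψ` plus the contractible piece
`Compl ⊕ 𝐝 Compl`.

For (2), the homology of the source is computed cone by cone. A cocycle `(θ, λ)` has `θ = -dλ`, so
it is determined by `ω = λ`, and the boundaries are the sums `θ + dλ'` (`exists_hcCone_eq`,
`exists_coneD_eq_hcCone_iff`).

For (3), `M ≥ 1` and `L - M ≥ 1` make `coordD` divisible by `p` (`exists_smul_coordD_eq`). The
decomposition survives reduction, so the homology modulo `p` is `𝐂_n / p`. Each `Ω^s` with `0 ≤ s ≤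
n` occurs exactly once in `𝐂_n`, and `Ω^s_A / p` is `Ω^s_{A_1/k}` (`exists_specialFibre_reduction`).
Modulo `p` only the terms of `Ψ` in the leading summands remain, which identifies the classes. -/

namespace RelCyclic

/-! ### Formulas for `Ψ` in coordinates and the splitting of the target. -/

section Decomposition
variable (R : Type*) (A : Type*) [CommRing R] [CommRing A] [Algebra R A]

/-- The differential of the source in the coordinates `(η, κ)`, where `η_{m+1} = x.1 m` and
`κ_m = x.2 m`. -/
noncomputable def coordD (p L M : ℕ) : EForms R A →ₗ[R] EForms R A where
  toFun x := (fun m => -((p : R) ^ L • Forms.d R A (x.1 (m + 1))),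
    fun m => (p : R) ^ ((m + 1) * (L - M)) • x.1 m + (p : R) ^ M • Forms.d R A (x.2 (m + 1)))
  map_add' x y := by
    ext m
    · simp [add_comm]
    · simp [add_add_add_comm]
  map_smul' a x := by
    ext m
    · simp [smul_comm _ a]
    · simp [smul_comm _ a]

/-- The first component of `Ψ` in the coordinates `(η, κ)`. -/
noncomputable def coordFst (p L M : ℕ) : EForms R A →ₗ[R] (ℕ → EForms R A) where
  toFun x i := (fun m => ((-1 : R) ^ m * (p : R) ^ (i * L)) • x.1 (i + m),
    fun m => if m = 0 then (p : R) ^ ((i + 1) * M) • x.2 i else 0)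
  map_add' x y := by
    ext i m
    · simp
    · by_cases h : m = 0 <;> simp [h]
  map_smul' a x := by
    ext i m
    · simp [smul_comm _ a]
    · by_cases h : m = 0 <;> simp [h, smul_comm _ a]

/-- The second component of `Ψ` in the coordinates `(η, κ)`. -/
noncomputable def coordSnd (p M : ℕ) : EForms R A →ₗ[R] (ℕ → EForms R A) where
  toFun x i := (fun m => ((-1 : R) ^ m * (p : R) ^ (i * M)) • x.2 (i + m), 0)
  map_add' x y := by
    ext i m <;> simp
  map_smul' a x := by
    ext i m <;> simp [smul_comm _ a]

variable {R A}

lemma coordD_mem (p L M : ℕ) {n n' : ℤ} (h : n' + 1 = n) {x : EForms R A} (hx : x ∈ C R A n) :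
    coordD R A p L M x ∈ C R A n' := by
  subst h
  intro m
  have h1 := (hx (m + 1)).1
  have h2 := (hx m).1
  have h3 := (hx (m + 1)).2
  refine ⟨neg_mem (Submodule.smul_mem _ _ (d_mem_Om R A (by push_cast; ring) h1)),
    add_mem (Submodule.smul_mem _ _ ?_)
      (Submodule.smul_mem _ _ (d_mem_Om R A (by push_cast; ring) h3))⟩
  rwa [show n' + 1 - 2 * (m : ℤ) - 1 = n' - 2 * m by ring] at h2

lemma coordFst_mem (p L M : ℕ) {n : ℤ} {x : EForms R A} (hx : x ∈ C R A n) :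
    coordFst R A p L M x ∈ CC R A n := by
  intro i m
  constructor
  · have := (hx (i + m)).1
    rw [show n - 2 * ((i + m : ℕ) : ℤ) - 1 = n - 2 * i - 2 * m - 1 by push_cast; ring] at this
    exact Submodule.smul_mem _ _ this
  · by_cases h : m = 0
    · subst h
      simpa [coordFst] using Submodule.smul_mem _ ((p : R) ^ ((i + 1) * M)) (hx i).2
    · simp [coordFst, h]

lemma coordSnd_mem (p M : ℕ) {n : ℤ} {x : EForms R A} (hx : x ∈ C R A n) :
    coordSnd R A p M x ∈ CC R A (n + 1) := by
  intro i m
  constructor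
  · have := (hx (i + m)).2
    rw [show n - 2 * ((i + m : ℕ) : ℤ) = n + 1 - 2 * i - 2 * m - 1 by push_cast; ring] at this
    exact Submodule.smul_mem _ _ this
  · exact zero_mem _

/-- The alternating signs in `Ψ` make this telescope: at `(dε)^{m+1}`, `δ` of the summand `i` and
`B` of the summand `i + 1` both carry `p^{(i+1)L}`, with opposite signs. At `(dε)^0` only `δ` and
`dλ` contribute, and they give the `κ`-part of `coordD`. -/
lemma DD_coordFst (p : ℕ) {L M : ℕ} (hML : M < L) (x : EForms R A) :
    DD R A ((p : R) ^ L) (coordFst R A p L M x) = coordFst R A p L M (coordD R A p L M x) := by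
  obtain ⟨e, rfl⟩ := Nat.exists_eq_add_of_le hML.le
  ext i m
  · have h : i + 1 + m = i + m + 1 := by omega
    simp [DD, coordFst, coordD, δ, B, h, smul_smul]
    congr 1
    ring
  · cases m with
    | zero =>
      simp [DD, coordFst, coordD, δ, B, smul_smul, ← pow_add]
      congr 2 <;> ring
    | succ m =>
      have h : i + 1 + m = i + (m + 1) := by omega
      simp only [DD, coordFst, coordD, δ, B, h, LinearMap.coe_mk, AddHom.coe_mk, smul_smul,
        Prod.snd_add, Pi.add_apply]
      simp only [Nat.add_eq_zero_iff, one_ne_zero, and_false, if_false, map_zero, zero_add,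
        ← add_smul]
      convert zero_smul R _ using 2
      ring

/-- The term `λ` of `Ψ` is needed here: the transition map fixes it, and it cancels `δ` of the
`ε(dε)^0`-term of the second component. At `(dε)^{m+1}` the sum telescopes over `p^M`. -/
lemma transCC_coordFst (p : ℕ) {L M : ℕ} (hML : M < L) (x : EForms R A) :
    transCC R A p (L - M) (coordFst R A p L M x) -
      DD R A ((p : R) ^ M) (coordSnd R A p M x) = coordSnd R A p M (coordD R A p L M x) := by
  obtain ⟨e, rfl⟩ := Nat.exists_eq_add_of_le hML.le
  ext i m
  · have h : i + 1 + m = i + m + 1 := by omega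
    simp [DD, transCC, transE, coordFst, coordSnd, coordD, δ, B, h, smul_smul]
    congr 2 <;> ring
  · cases m with
    | zero =>
      simp [DD, transCC, transE, coordFst, coordSnd, coordD, δ, B, smul_smul, ← pow_add]
      rw [sub_eq_zero]
      congr 2; ring
    | succ m =>
      have h : i + 1 + m = i + (m + 1) := by omega
      simp [DD, transCC, transE, coordFst, coordSnd, coordD, δ, B, h, smul_smul, ← add_smul]
      convert zero_smul R _ using 2
      ring

/-- The differential of `𝐂𝐂(A_L, A_M)` on families. -/
noncomputable def pairD (p L M : ℕ) (z : (ℕ → EForms R A) × (ℕ → EForms R A)) :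
    (ℕ → EForms R A) × (ℕ → EForms R A) :=
  (DD R A ((p : R) ^ L) z.1, transCC R A p (L - M) z.1 - DD R A ((p : R) ^ M) z.2)

variable (R A) in
/-- A complement of the image of `Ψ` modulo boundaries: no terms `α ε (dε)^m` in the leading
summand of either component, no `β (dε)^m` in the second one, and none with `m > 0` in the
first one. -/
def Compl : Submodule R ((ℕ → EForms R A) × (ℕ → EForms R A)) where
  carrier := {z | (∀ m, (z.1 0).1 m = 0) ∧ (∀ i m, (z.1 i).2 (m + 1) = 0) ∧
    (∀ m, (z.2 0).1 m = 0) ∧ ∀ i m, (z.2 i).2 m = 0}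
  add_mem' hx hy := by
    refine ⟨fun m => ?_, fun i m => ?_, fun m => ?_, fun i m => ?_⟩
    · simp [hx.1 m, hy.1 m]
    · simp [hx.2.1 i m, hy.2.1 i m]
    · simp [hx.2.2.1 m, hy.2.2.1 m]
    · simp [hx.2.2.2 i m, hy.2.2.2 i m]
  zero_mem' := by simp
  smul_mem' a x hx := by
    refine ⟨fun m => ?_, fun i m => ?_, fun m => ?_, fun i m => ?_⟩
    · simp [hx.1 m]
    · simp [hx.2.1 i m]
    · simp [hx.2.2.1 m]
    · simp [hx.2.2.2 i m]

/-- The equations form a triangular system with unit diagonal. The coefficients of the plain terms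
determine `k'`, the `ε`-terms in the summand `0` then determine `x`, and `k` is what is left. No
division by `p` occurs. -/
lemma compl_unique {p L M : ℕ} {x : EForms R A}
    {k k' : (ℕ → EForms R A) × (ℕ → EForms R A)} (hk : k ∈ Compl R A) (hk' : k' ∈ Compl R A)
    (h : (coordFst R A p L M x, coordSnd R A p M x) + k + pairD p L M k' = 0) :
    x = 0 ∧ k = 0 ∧ k' = 0 := by
  obtain ⟨⟨a, b⟩, c⟩ : _ ∧ _ := ⟨Prod.ext_iff.mp h, hk⟩
  simp only [Prod.fst_add, Prod.snd_add, Prod.fst_zero, Prod.snd_zero] at a b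
  have a1 (i m) := congrFun (congrArg Prod.fst (congrFun a i)) m
  have a2 (i m) := congrFun (congrArg Prod.snd (congrFun a i)) m
  have b1 (i m) := congrFun (congrArg Prod.fst (congrFun b i)) m
  have b2 (i m) := congrFun (congrArg Prod.snd (congrFun b i)) m
  obtain ⟨h1, h2, h3, h4⟩ := hk
  obtain ⟨h1', h2', h3', h4'⟩ := hk'
  simp only [pairD, DD, transCC, transE, coordFst, coordSnd, δ, B, LinearMap.coe_mk,
    AddHom.coe_mk, Pi.add_apply, Prod.fst_add, Prod.snd_add, Pi.zero_apply, Prod.fst_zero,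
    Prod.snd_zero, Pi.sub_apply, Prod.fst_sub, Prod.snd_sub] at a1 a2 b1 b2
  -- The coefficient of `(dε)^{m+1}` in the summand `i` reads `p^M b_i(m+1) + b_{i+1}(m) = 0` up to
  -- sign, where `b_i` are the `ε`-coefficients of the second component of `k'`; and `b_0 = 0`.
  have e1 (i) : ∀ m, (k'.2 i).1 m = 0 := by
    induction i with
    | zero => exact h3'
    | succ i ih =>
      intro m
      simpa [h4, h4', h2', ih] using b2 i (m + 1)
  -- At `(dε)^0` the transition map has coefficient `p^0 = 1`.
  have e2 (i) : (k'.1 i).2 0 = 0 := by simpa [h4, h4', e1] using b2 i 0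
  have e3 (i) : ∀ m, (k'.1 i).1 m = 0 := by
    induction i with
    | zero => exact h1'
    | succ i ih =>
      intro m
      simpa [h2, h2', ih] using a2 i (m + 1)
  have u (m : ℕ) : IsUnit ((-1 : R) ^ m) := (isUnit_neg_one).pow m
  -- In the summand `0`, `k` has no `ε`-terms, and the coefficients of `Ψ(x)` there are the signs
  -- `(-1)^m`.
  have f1 (m) : x.1 m = 0 := by simpa [h1, e3, (u m).smul_eq_zero] using a1 0 m
  have f2 (m) : x.2 m = 0 := by simpa [h3, e1, e3, (u m).smul_eq_zero] using b1 0 m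
  refine ⟨Prod.ext (funext f1) (funext f2), ?_, ?_⟩
  · ext i m
    · simpa [e3, f1] using a1 i m
    · cases m with
      | zero => simpa [e2, e3, f2] using a2 i 0
      | succ m => exact h2 i m
    · simpa [e1, e3, f2] using b1 i m
    · exact h4 i m
  · ext i m
    · exact e3 i m
    · cases m with
      | zero => exact e2 i
      | succ m => exact h2' i m
    · exact e1 i m
    · exact h4' i m

/-- The solution of `c a_i + a_{i+1} = β_i` along antidiagonals, with `a_0 = 0`. -/
noncomputable def antidiag (c : R) (β : ℕ → ℕ → Forms R A) : ℕ → ℕ → Forms R A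
  | 0 => 0
  | i + 1 => fun m => β i (m + 1) - c • antidiag c β i (m + 1)

lemma antidiag_mem (c : R) {β : ℕ → ℕ → Forms R A} {n : ℤ}
    (h : ∀ i m : ℕ, β i m ∈ Om R A (n - 2 * i - 2 * m)) (i m : ℕ) :
    antidiag c β i m ∈ Om R A (n + 1 - 2 * i - 2 * m - 1) := by
  induction i generalizing m with
  | zero => exact zero_mem _
  | succ i ih =>
    refine sub_mem ?_ (Submodule.smul_mem _ _ ?_)
    · convert h i (m + 1) using 1
      push_cast; ring_nf
    · convert ih (m + 1) using 1
      push_cast; ring_nf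

/-- Solves the triangular system of `compl_unique` with a general right-hand side. The remainder `k`
is defined by subtraction, and only the vanishing of its forbidden coefficients has to be checked.
-/
lemma compl_exists (p L M : ℕ) {n : ℤ} {z : (ℕ → EForms R A) × (ℕ → EForms R A)}
    (hz1 : z.1 ∈ CC R A n) (hz2 : z.2 ∈ CC R A (n + 1)) :
    ∃ x ∈ C R A n, ∃ k ∈ Compl R A, ∃ k' ∈ Compl R A,
      k'.1 ∈ CC R A (n + 1) ∧ k'.2 ∈ CC R A (n + 1 + 1) ∧
      (coordFst R A p L M x, coordSnd R A p M x) + k + pairD p L M k' = z := by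
  -- `a` and `b` are the `ε`-coefficients of `k'`, forced by the coefficients of `(dε)^{m+1}` in
  -- `z`. The sign in `b` comes from `-𝐃 υ` in the differential.
  set a := antidiag ((p : R) ^ L) fun i m => (z.1 i).2 m with ha
  set b := antidiag ((p : R) ^ M) fun i m => -(z.2 i).2 m with hb
  have hma (i m) := antidiag_mem ((p : R) ^ L) (fun i m => (hz1 i m).2) i m
  have hmb (i m) := antidiag_mem ((p : R) ^ M) (fun i m => neg_mem (hz2 i m).2) i m
  rw [← ha] at hma
  rw [← hb] at hmb
  -- The plain term is chosen so that, under the transition map and after subtracting `p^M b i 0`,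
  -- it produces `(z.2 i).2 0`.
  set k' : (ℕ → EForms R A) × (ℕ → EForms R A) :=
    (fun i => (a i, fun m => if m = 0 then (z.2 i).2 0 + (p : R) ^ M • b i 0 else 0),
      fun i => (b i, 0)) with hk'
  -- In the summand `0` the differential of `k'` contributes `-d a_1` to the `ε`-terms of the first
  -- component and `d b_1` to those of the second; `x` must supply the rest.
  set x : EForms R A := (fun m => (-1 : R) ^ m • ((z.1 0).1 m + Forms.d R A (a 1 m)),
    fun m => (-1 : R) ^ m • ((z.2 0).1 m - Forms.d R A (b 1 m))) with hx
  have sq (m : ℕ) (y : Forms R A) : (-1 : R) ^ m • (-1 : R) ^ m • y = y := by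
    rw [smul_smul, ← mul_pow]; simp
  refine ⟨x, fun m => ⟨?_, ?_⟩, z - (coordFst R A p L M x, coordSnd R A p M x) - pairD p L M k',
    ?_, k', ?_, ?_, ?_, by abel⟩
  · refine Submodule.smul_mem _ _ (add_mem (by simpa using (hz1 0 m).1) ?_)
    exact d_mem_Om R A (by push_cast; ring) (hma 1 m)
  · refine Submodule.smul_mem _ _ (sub_mem ?_ ?_)
    · convert (hz2 0 m).1 using 1
      push_cast; ring_nf
    · exact d_mem_Om R A (by push_cast; ring) (hmb 1 m)
  · refine ⟨fun m => ?_, fun i m => ?_, fun m => ?_, fun i m => ?_⟩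
    · simp [pairD, DD, coordFst, δ, B, hx, hk', sq]
    · simp [pairD, DD, coordFst, δ, B, hk', ha, antidiag]
    · have h0 (m) : a 0 m = 0 := rfl
      simp [pairD, DD, transCC, transE, coordSnd, δ, B, hx, hk', sq, h0]
    · cases m with
      | zero => simp [pairD, DD, transCC, transE, coordSnd, δ, B, hk']
      | succ m => simp [pairD, DD, transCC, transE, coordSnd, δ, B, hk', hb, antidiag]
  · exact ⟨fun m => rfl, fun i m => rfl, fun m => rfl, fun i m => rfl⟩
  · intro i m
    refine ⟨hma i m, ?_⟩
    by_cases h : m = 0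
    · subst h
      simp only [hk', if_true]
      refine add_mem (hz2 i 0).2 (Submodule.smul_mem _ _ ?_)
      convert hmb i 0 using 1
      ring_nf
    · simp [hk', h]
  · intro i m
    exact ⟨hmb i m, zero_mem _⟩

end Decomposition

/-! ### Computing homology with representing cocycles. -/

section Homology
universe v u
variable {R : Type u} [CommRing R] {K : CochainComplex (ModuleCat.{v} R) ℤ}

lemma Represents.d_eq_zero {i : ℤ} {z : K.X i} {h : K.homology i} (H : Represents z h) (j : ℤ) :
    K.d i j z = 0 := by
  obtain ⟨c, rfl, -⟩ := H
  rw [← ModuleCat.comp_apply, K.iCycles_d]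
  rfl

lemma exists_represents_of_d_eq_zero {i j : ℤ} (hij : i + 1 = j) {z : K.X i} (hz : K.d i j z = 0) :
    ∃ h : K.homology i, Represents z h := by
  have hz' : z ∈ LinearMap.ker (K.sc i).g.hom := by
    have hn : (ComplexShape.up ℤ).next i = j := by simp [← hij]
    change K.d i ((ComplexShape.up ℤ).next i) z = 0
    rw [hn, hz]
  refine ⟨_, (K.sc i).moduleCatCyclesIso.inv ⟨z, hz'⟩, ?_, rfl⟩
  change ((K.sc i).moduleCatCyclesIso.inv ≫ (K.sc i).iCycles) ⟨z, hz'⟩ = z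
  rw [ShortComplex.moduleCatCyclesIso_inv_iCycles]
  rfl

lemma exists_represents {i : ℤ} (h : K.homology i) : ∃ z : K.X i, Represents z h := by
  obtain ⟨c, rfl⟩ := (ModuleCat.epi_iff_surjective (K.homologyπ i)).mp inferInstance h
  exact ⟨_, c, rfl, rfl⟩

lemma Represents.add {i : ℤ} {z z' : K.X i} {h h' : K.homology i} (H : Represents z h)
    (H' : Represents z' h') : Represents (z + z') (h + h') := by
  obtain ⟨c, rfl, rfl⟩ := H
  obtain ⟨c', rfl, rfl⟩ := H'
  exact ⟨c + c', map_add _ _ _, map_add _ _ _⟩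

lemma Represents.smul {i : ℤ} {z : K.X i} {h : K.homology i} (a : R) (H : Represents z h) :
    Represents (a • z) (a • h) := by
  obtain ⟨c, rfl, rfl⟩ := H
  exact ⟨a • c, map_smul _ _ _, map_smul _ _ _⟩

lemma Represents.map {K' : CochainComplex (ModuleCat.{v} R) ℤ} (φ : K ⟶ K') {i : ℤ} {z : K.X i}
    {h : K.homology i} (H : Represents z h) :
    Represents (φ.f i z) (HomologicalComplex.homologyMap φ i h) := by
  obtain ⟨c, rfl, rfl⟩ := H
  refine ⟨HomologicalComplex.cyclesMap φ i c, ?_, ?_⟩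
  · rw [← ModuleCat.comp_apply, ← ModuleCat.comp_apply, HomologicalComplex.cyclesMap_i]
  · rw [← ModuleCat.comp_apply, ← ModuleCat.comp_apply,
      HomologicalComplex.homologyπ_naturality]

/-- Homology is the cokernel of `toCycles`, so a cycle with zero class lies in the image of
`toCycles`; injectivity of `iCycles` handles the converse. -/
lemma Represents.eq_zero_iff {i j : ℤ} (hij : i + 1 = j) {z : K.X j} {h : K.homology j}
    (H : Represents z h) : h = 0 ↔ ∃ w : K.X i, K.d i j w = z := by
  obtain ⟨c, rfl, rfl⟩ := H
  have hp : (ComplexShape.up ℤ).prev j = i := by simp [← hij]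
  have hex := ShortComplex.exact_of_g_is_cokernel
    (ShortComplex.mk (K.toCycles i j) (K.homologyπ j) (by simp))
    (K.homologyIsCokernel i j hp)
  rw [ShortComplex.moduleCat_exact_iff] at hex
  constructor
  · intro h
    obtain ⟨w, hw⟩ := hex c h
    refine ⟨w, ?_⟩
    change K.toCycles i j w = c at hw
    rw [← hw, ← ModuleCat.comp_apply, K.toCycles_i]
  · rintro ⟨w, hw⟩
    have : c = K.toCycles i j w := by
      apply (ModuleCat.mono_iff_injective (K.iCycles j)).mp inferInstance
      rw [← hw, ← ModuleCat.comp_apply, K.toCycles_i]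
    rw [this, ← ModuleCat.comp_apply, K.toCycles_comp_homologyπ]
    rfl

lemma Represents.zero_left {i : ℤ} {h : K.homology i} (H : Represents (0 : K.X i) h) : h = 0 :=
  (H.eq_zero_iff (i := i - 1) (by ring)).mpr ⟨0, map_zero _⟩

lemma Represents.unique {i : ℤ} {z : K.X i} {h h' : K.homology i} (H : Represents z h)
    (H' : Represents z h') : h = h' := by
  have := H.add (H'.smul (-1 : R))
  rw [neg_one_smul, neg_one_smul, add_neg_cancel] at this
  exact add_neg_eq_zero.mp this.zero_left

/-- A linear family of cocycles which contains all classes induces a surjection onto homology. -/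
lemma exists_linearMap_represents {X : Type*} [AddCommGroup X] [Module R X] {i j l : ℤ}
    (hij : i + 1 = j) (hjl : j + 1 = l) (g : X →ₗ[R] K.X j) (hg : ∀ x, K.d j l (g x) = 0)
    (hs : ∀ z, K.d j l z = 0 → ∃ x w, z = g x + K.d i j w) :
    ∃ f : X →ₗ[R] K.homology j, Function.Surjective f ∧ (∀ x, Represents (g x) (f x)) ∧
      ∀ x, f x = 0 ↔ ∃ w, K.d i j w = g x := by
  choose f hf using fun x => exists_represents_of_d_eq_zero hjl (hg x)
  refine ⟨⟨⟨f, fun x y => ?_⟩, fun a x => ?_⟩, fun h => ?_, hf, fun x => (hf x).eq_zero_iff hij⟩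
  · refine (hf _).unique ?_
    rw [map_add]
    exact (hf x).add (hf y)
  · refine (hf _).unique ?_
    rw [map_smul]
    exact (hf x).smul a
  · obtain ⟨z, hz⟩ := exists_represents h
    obtain ⟨x, w, hw⟩ := hs z (hz.d_eq_zero l)
    refine ⟨x, ?_⟩
    have h1 := hz.add ((hf x).smul (-1 : R))
    rw [neg_one_smul, neg_one_smul] at h1
    have h2 := (h1.eq_zero_iff hij).mpr ⟨w, by rw [hw]; abel⟩
    exact (add_neg_eq_zero.mp h2).symm

/-- `hs` gives surjectivity and `hi` injectivity on homology. -/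
lemma quasiIso_of_elements {S T : CochainComplex (ModuleCat.{v} R) ℤ} (φ : S ⟶ T)
    (hs : ∀ i j l : ℤ, i + 1 = j → j + 1 = l → ∀ z, T.d j l z = 0 →
      ∃ x w, S.d j l x = 0 ∧ z = φ.f j x + T.d i j w)
    (hi : ∀ i j : ℤ, i + 1 = j → ∀ x w, φ.f j x = T.d i j w → ∃ y, S.d i j y = x) :
    QuasiIso φ := by
  rw [quasiIso_iff]
  intro j
  rw [quasiIsoAt_iff_isIso_homologyMap, ConcreteCategory.isIso_iff_bijective]
  constructor
  · rw [injective_iff_map_eq_zero]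
    intro h hh
    obtain ⟨x, hx⟩ := exists_represents h
    have h1 := hx.map φ
    rw [hh] at h1
    obtain ⟨w, hw⟩ := (h1.eq_zero_iff (i := j - 1) (by ring)).mp rfl
    exact (hx.eq_zero_iff (i := j - 1) (by ring)).mpr (hi _ _ (by ring) x w hw.symm)
  · intro h
    obtain ⟨z, hz⟩ := exists_represents h
    obtain ⟨x, w, hx, hzw⟩ := hs (j - 1) j (j + 1) (by ring) rfl z (hz.d_eq_zero _)
    obtain ⟨h', hh'⟩ := exists_represents_of_d_eq_zero rfl hx
    refine ⟨h', ?_⟩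
    have h1 := hz.add ((hh'.map φ).smul (-1 : R))
    rw [neg_one_smul, neg_one_smul] at h1
    have h2 := (h1.eq_zero_iff (i := j - 1) (by ring)).mpr ⟨w, by rw [hzw]; abel⟩
    exact (add_neg_eq_zero.mp h2).symm

end Homology

/-! ### Differential forms of a smooth algebra have no `p`-torsion. -/

section Torsion

/-- A projective module is a retract of a free one, so its exterior power embeds in a free module,
where a nonzerodivisor acts injectively on each coordinate. -/
lemma exteriorPower_smul_eq_zero {A V : Type*} [CommRing A] [AddCommGroup V] [Module A V]
    [Module.Projective A V] {a : A} (ha : ∀ b : A, a * b = 0 → b = 0) (n : ℕ) {x : ⋀[A]^n V}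
    (hx : a • x = 0) : x = 0 := by
  obtain ⟨s, hs⟩ := Module.projective_def'.mp (inferInstance : Module.Projective A V)
  refine (injective_iff_map_eq_zero _).mp (exteriorPower.map_injective (n := n) _ hs) x ?_
  have h : a • exteriorPower.map n s x = 0 := by rw [← map_smul, hx, map_zero]
  obtain ⟨I, b⟩ := Module.Free.exists_basis A (⋀[A]^n (V →₀ A))
  refine b.repr.injective (Finsupp.ext fun i => ?_)
  rw [map_zero]
  exact ha _ (by simpa using congrArg (fun y => b.repr y i) h)

lemma exteriorAlgebra_smul_eq_zero {A V : Type*} [CommRing A] [AddCommGroup V] [Module A V]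
    [Module.Projective A V] {a : A} (ha : ∀ b : A, a * b = 0 → b = 0) {x : ExteriorAlgebra A V}
    (hx : a • x = 0) : x = 0 := by
  refine (DirectSum.decompose fun n : ℕ => ⋀[A]^n V).injective ?_
  rw [DirectSum.decompose_zero]
  refine DFinsupp.ext fun n => exteriorPower_smul_eq_zero ha n ?_
  have := congrArg (fun y => DirectSum.decompose (fun n : ℕ => ⋀[A]^n V) y n) hx
  rwa [DirectSum.decompose_smul, DirectSum.decompose_zero] at this

/-- Smoothness enters twice: `Ω^1` is projective, and `A` is flat over the domain `W(k)`, so that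
`p` is a nonzerodivisor on `A`. -/
lemma forms_torsionFree (p : ℕ) [Fact p.Prime] (k : Type*) [Field k] [CharP k p]
    [PerfectRing k p] (A : Type*) [CommRing A] [Algebra (WittVector p k) A]
    [Algebra.Smooth (WittVector p k) A] (x : Forms (WittVector p k) A)
    (hx : (p : WittVector p k) • x = 0) : x = 0 := by
  have hp : (p : WittVector p k) ≠ 0 := WittVector.p_nonzero p k
  have : Module.Flat (WittVector p k) A := inferInstance
  refine exteriorAlgebra_smul_eq_zero (a := algebraMap (WittVector p k) A p) (fun b hb => ?_)
    (x := x) (by rwa [algebraMap_smul])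
  rw [← Algebra.smul_def] at hb
  exact (smul_eq_zero.mp hb).resolve_left hp

end Torsion

/-! ### Forms on a quotient `A₁ = A/c` with `c` in the base: `Ω^s_A / c = Ω^s_{A₁}`. -/

section Reduction
open TensorProduct
variable (R A k A₁ : Type*) [CommRing R] [CommRing A] [CommRing k] [CommRing A₁]
  [Algebra R A] [Algebra k A₁] [Algebra A A₁] [Algebra R k] [Algebra R A₁]
  [IsScalarTower R A A₁] [IsScalarTower R k A₁] [SMulCommClass k A A₁]

/-- The map `Ω^•_{A/R} → Ω^•_{A₁/k}` induced by a commutative square of rings. -/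
noncomputable def formsMap : Forms R A →ₐ[A] Forms k A₁ :=
  ExteriorAlgebra.lift A ⟨((ExteriorAlgebra.ι A₁).restrictScalars A).comp
    (KaehlerDifferential.map R k A A₁), fun v => by simp⟩

lemma formsMap_ι (v : Ω[A⁄R]) : formsMap R A k A₁ (ExteriorAlgebra.ι A v) =
    ExteriorAlgebra.ι A₁ (KaehlerDifferential.map R k A A₁ v) :=
  ExteriorAlgebra.lift_ι_apply A _ _ v

lemma formsMap_smul (a : A) (x : Forms R A) :
    formsMap R A k A₁ (a • x) = algebraMap A A₁ a • formsMap R A k A₁ x := by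
  rw [map_smul, algebraMap_smul]

lemma formsMap_mem {s : ℕ} {x : Forms R A} (hx : x ∈ ⋀[A]^s (Ω[A⁄R])) :
    formsMap R A k A₁ x ∈ ⋀[A₁]^s (Ω[A₁⁄k]) := by
  induction s generalizing x with
  | zero =>
    rw [ExteriorAlgebra.exteriorPower, pow_zero] at hx ⊢
    obtain ⟨a, rfl⟩ := Submodule.mem_one.mp hx
    rw [AlgHom.commutes, IsScalarTower.algebraMap_apply A A₁]
    exact Submodule.mem_one.mpr ⟨_, rfl⟩
  | succ n ih =>
    rw [ExteriorAlgebra.exteriorPower, pow_succ'] at hx ⊢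
    refine Submodule.mul_induction_on hx ?_ ?_
    · rintro _ ⟨v, rfl⟩ y hy
      rw [map_mul, formsMap_ι]
      exact Submodule.mul_mem_mul ⟨_, rfl⟩ (ih hy)
    · intro a b ha hb
      rw [map_add]
      exact add_mem ha hb

variable {R A k A₁}

lemma formsMap_surjOn (hA : Function.Surjective (algebraMap A A₁)) {s : ℕ} {y : Forms k A₁}
    (hy : y ∈ ⋀[A₁]^s (Ω[A₁⁄k])) : ∃ x ∈ ⋀[A]^s (Ω[A⁄R]), formsMap R A k A₁ x = y := by
  induction s generalizing y with
  | zero =>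
    rw [ExteriorAlgebra.exteriorPower, pow_zero] at hy
    obtain ⟨b, rfl⟩ := Submodule.mem_one.mp hy
    obtain ⟨a, rfl⟩ := hA b
    refine ⟨algebraMap A _ a, ?_, ?_⟩
    · rw [ExteriorAlgebra.exteriorPower, pow_zero]
      exact Submodule.mem_one.mpr ⟨_, rfl⟩
    · rw [AlgHom.commutes, IsScalarTower.algebraMap_apply A A₁]
  | succ n ih =>
    rw [ExteriorAlgebra.exteriorPower, pow_succ'] at hy
    refine Submodule.mul_induction_on hy ?_ ?_
    · rintro _ ⟨v, rfl⟩ y hy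
      obtain ⟨u, rfl⟩ := KaehlerDifferential.map_surjective_of_surjective R k A A₁ hA v
      obtain ⟨x, hx, rfl⟩ := ih hy
      refine ⟨ExteriorAlgebra.ι A u * x, ?_, by rw [map_mul, formsMap_ι]⟩
      rw [ExteriorAlgebra.exteriorPower, pow_succ']
      exact Submodule.mul_mem_mul ⟨_, rfl⟩ hx
    · rintro _ _ ⟨x, hx, rfl⟩ ⟨y, hy, rfl⟩
      exact ⟨x + y, add_mem hx hy, map_add _ _ _⟩

lemma formsMap_smul_ιMulti (a : A) {s : ℕ} (b : Fin s → A) :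
    formsMap R A k A₁ (a • ExteriorAlgebra.ιMulti A s fun i => KaehlerDifferential.D R A (b i)) =
      algebraMap A A₁ a • ExteriorAlgebra.ιMulti A₁ s
        fun i => KaehlerDifferential.D k A₁ (algebraMap A A₁ (b i)) := by
  rw [formsMap_smul, ExteriorAlgebra.ιMulti_apply, ExteriorAlgebra.ιMulti_apply, map_list_prod,
    List.map_ofFn]
  congr 3
  ext i
  simp [formsMap_ι]

/-- An inverse of `formsMap` modulo the kernel of `A → A₁`. -/
lemma exists_formsMap_retraction {c : R} (hA : Function.Surjective (algebraMap A A₁))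
    (hk : Function.Surjective (algebraMap R k))
    (hc : RingHom.ker (algebraMap A A₁) = Ideal.span {algebraMap R A c}) :
    ∃ σ : Forms k A₁ →ₐ[A₁] A₁ ⊗[A] Forms R A, ∀ x, σ (formsMap R A k A₁ x) = 1 ⊗ₜ x := by
  -- Two lifts differ by `c e` with `c` in the base ring, so their differentials differ by `c de`,
  -- which dies in `A₁ ⊗ Ω`. Hence `a mod c ↦ 1 ⊗ da` is well defined; it is a derivation, and the
  -- universal properties of Kähler differentials and of the exterior algebra extend it to `σ`.
  have hwd (a b : A) (h : algebraMap A A₁ a = algebraMap A A₁ b) :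
      (1 : A₁) ⊗ₜ[A] Forms.dOne R A a = 1 ⊗ₜ Forms.dOne R A b := by
    have h1 : a - b ∈ RingHom.ker (algebraMap A A₁) := by
      rw [RingHom.mem_ker, map_sub, h, sub_self]
    have h0 : algebraMap A A₁ (algebraMap R A c) = 0 := by
      rw [← RingHom.mem_ker, hc]
      exact Ideal.mem_span_singleton_self _
    rw [hc, Ideal.mem_span_singleton'] at h1
    obtain ⟨e, he⟩ := h1
    rw [← sub_eq_zero, ← tmul_sub, Forms.dOne, Forms.dOne, ← map_sub, ← map_sub, ← he, mul_comm,
      ← Algebra.smul_def, Derivation.map_smul, ← algebraMap_smul A, map_smul, ← smul_tmul,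
      Algebra.smul_def, h0, zero_mul, zero_tmul]
  -- `s` is only a set-theoretic section; `hwd` allows it to be replaced by any other lift.
  choose s hs using id hA
  let D₀ : A₁ →ₗ[k] A₁ ⊗[A] Forms R A :=
    { toFun := fun x => 1 ⊗ₜ Forms.dOne R A (s x)
      map_add' := fun x y => by
        rw [← tmul_add, hwd (s (x + y)) (s x + s y) (by simp [hs])]
        simp [Forms.dOne]
      map_smul' := fun r x => by
        obtain ⟨r, rfl⟩ := hk r
        rw [hwd (s (algebraMap R k r • x)) (r • s x) (by
          rw [hs, algebraMap_smul, Algebra.smul_def r (s x), map_mul,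
            ← IsScalarTower.algebraMap_apply, hs, ← Algebra.smul_def])]
        rw [RingHom.id_apply, smul_tmul', algebraMap_smul, smul_tmul, Forms.dOne,
          Derivation.map_smul, ← algebraMap_smul A, map_smul, algebraMap_smul, Forms.dOne] }
  have hD (a : A) : D₀ (algebraMap A A₁ a) = 1 ⊗ₜ Forms.dOne R A a := hwd _ _ (hs _)
  let D : Derivation k A₁ (A₁ ⊗[A] Forms R A) := Derivation.mk' D₀ fun x y => by
    rw [← hs x, ← hs y, ← map_mul, hD, hD, hD, Forms.dOne_mul, tmul_add, ← smul_tmul, ← smul_tmul,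
      smul_tmul', smul_tmul']
    simp [Algebra.smul_def]
  have hj (u : Ω[A⁄R]) : D.liftKaehlerDifferential (KaehlerDifferential.map R k A A₁ u) =
      1 ⊗ₜ ExteriorAlgebra.ι A u := by
    have hu : u ∈ Submodule.span A (Set.range (KaehlerDifferential.D R A)) := by
      rw [KaehlerDifferential.span_range_derivation]; trivial
    induction hu using Submodule.span_induction with
    | mem x hx =>
      obtain ⟨a, rfl⟩ := hx
      rw [KaehlerDifferential.map_D, Derivation.liftKaehlerDifferential_comp_D]
      exact hD a
    | zero => simp
    | add a b _ _ ha hb => rw [map_add, map_add, ha, hb, map_add, tmul_add]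
    | smul a b _ hb =>
      rw [map_smul, ← algebraMap_smul A₁ a, map_smul, hb, map_smul, tmul_smul, algebraMap_smul]
  have hsq (v : Ω[A₁⁄k]) : D.liftKaehlerDifferential v * D.liftKaehlerDifferential v = 0 := by
    obtain ⟨u, rfl⟩ := KaehlerDifferential.map_surjective_of_surjective R k A A₁ hA v
    rw [hj, Algebra.TensorProduct.tmul_mul_tmul]
    simp
  refine ⟨ExteriorAlgebra.lift A₁ ⟨D.liftKaehlerDifferential, hsq⟩, fun x => ?_⟩
  induction x using ExteriorAlgebra.induction with
  | algebraMap r =>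
    rw [AlgHom.commutes, IsScalarTower.algebraMap_apply A A₁, AlgHom.commutes,
      Algebra.TensorProduct.algebraMap_apply, Algebra.algebraMap_self_apply,
      Algebra.algebraMap_eq_smul_one, smul_tmul, Algebra.algebraMap_eq_smul_one]
  | ι v => rw [formsMap_ι, ExteriorAlgebra.lift_ι_apply, hj]
  | mul a b ha hb =>
    rw [map_mul, map_mul, ha, hb, Algebra.TensorProduct.tmul_mul_tmul, one_mul]
  | add a b ha hb => rw [map_add, map_add, ha, hb, tmul_add]

/-- This is `A₁ ⊗ F = F / cF`. -/
lemma one_tmul_eq_zero {F : Type*} [AddCommGroup F] [Module A F]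
    (hA : Function.Surjective (algebraMap A A₁)) {c : A}
    (hc : RingHom.ker (algebraMap A A₁) = Ideal.span {c}) {x : F}
    (hx : (1 : A₁) ⊗ₜ[A] x = 0) : ∃ y, c • y = x := by
  let e := Ideal.quotientKerAlgEquivOfSurjective (f := Algebra.ofId A A₁) hA
  have h1 : (1 : A ⧸ RingHom.ker (Algebra.ofId A A₁)) ⊗ₜ[A] x = 0 := by
    apply (LinearEquiv.rTensor F e.toLinearEquiv).injective
    rw [map_zero, LinearEquiv.rTensor_tmul]
    simpa using hx
  have h2 := congrArg (TensorProduct.quotTensorEquivQuotSMul F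
    (RingHom.ker (Algebra.ofId A A₁))) h1
  rw [← map_one (Ideal.Quotient.mk _), TensorProduct.quotTensorEquivQuotSMul_mk_tmul, one_smul,
    map_zero, Submodule.Quotient.mk_eq_zero] at h2
  have h3 : RingHom.ker (Algebra.ofId A A₁) = Ideal.span {c} := hc
  rw [h3, Submodule.ideal_span_singleton_smul] at h2
  obtain ⟨y, -, hy⟩ := (Submodule.mem_smul_pointwise_iff_exists _ _ _).mp h2
  exact ⟨y, hy⟩

/-- Applying the retraction `σ` to `formsMap x = 0` gives `1 ⊗ x = 0`, so `x` is divisible by `c`.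
-/
lemma exists_smul_of_formsMap_eq_zero {c : R} (hA : Function.Surjective (algebraMap A A₁))
    (hk : Function.Surjective (algebraMap R k))
    (hc : RingHom.ker (algebraMap A A₁) = Ideal.span {algebraMap R A c}) {s : ℕ} {x : Forms R A}
    (hx : x ∈ ⋀[A]^s (Ω[A⁄R])) (h : formsMap R A k A₁ x = 0) :
    ∃ y ∈ ⋀[A]^s (Ω[A⁄R]), c • y = x := by
  obtain ⟨σ, hσ⟩ := exists_formsMap_retraction (R := R) (k := k) hA hk hc
  obtain ⟨y, hy⟩ := one_tmul_eq_zero (F := Forms R A) hA hc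
    (by rw [← hσ, h, map_zero] : (1 : A₁) ⊗ₜ[A] x = 0)
  -- The quotient `y` need not be homogeneous; its component of degree `s` still satisfies `c y_s =
  -- x`.
  refine ⟨DirectSum.decompose (fun n : ℕ => ⋀[A]^n (Ω[A⁄R])) y s, SetLike.coe_mem _, ?_⟩
  rw [← algebraMap_smul A c, ← SetLike.val_smul]
  rw [← DirectSum.smul_apply, ← DirectSum.decompose_smul, hy,
    DirectSum.decompose_of_mem_same (fun n : ℕ => ⋀[A]^n (Ω[A⁄R])) hx]

end Reduction

/-! ### `Ψ` in coordinates is a quasi-isomorphism over any base. -/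

section Complexes
variable (R : Type*) (A : Type*) [CommRing R] [CommRing A] [Algebra R A]

lemma coordD_coordD (p : ℕ) {L M : ℕ} (hML : M < L) (x : EForms R A) :
    coordD R A p L M (coordD R A p L M x) = 0 := by
  obtain ⟨e, rfl⟩ := Nat.exists_eq_add_of_le hML.le
  ext m
  · simp [coordD, Forms.d_d]
  · simp only [coordD, LinearMap.coe_mk, AddHom.coe_mk, map_add, map_smul, Forms.d_d, smul_zero,
      add_zero, smul_neg, smul_smul, ← pow_add, Nat.add_sub_cancel_left, Prod.snd_zero,
      Pi.zero_apply]
    rw [neg_add_eq_zero]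
    congr 2
    ring

/-- The source in the coordinates `(η, κ)`. -/
noncomputable def coordCx (p : ℕ) {L M : ℕ} (hML : M < L) : CochainComplex (ModuleCat R) ℤ where
  X i := ModuleCat.of R (C R A (-i))
  d i j := if h : i + 1 = j then
      ModuleCat.ofHom (((coordD R A p L M).comp (C R A (-i)).subtype).codRestrict (C R A (-j))
        fun x => coordD_mem p L M (by omega) x.2)
    else 0
  shape i j h := dif_neg h
  d_comp_d' i j k hij hjk := by
    have hij' : i + 1 = j := hij
    have hjk' : j + 1 = k := hjk
    rw [dif_pos hij', dif_pos hjk', ← ModuleCat.ofHom_comp]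
    ext x : 2
    exact Subtype.ext (coordD_coordD R A p hML x.1)

variable {R A}
variable {p : ℕ} {L M : ℕ} {hML : M < L}

lemma coordCx_d {i j : ℤ} (hij : i + 1 = j) (x : C R A (-i)) :
    (coordCx R A p hML).d i j x =
      (⟨coordD R A p L M x, coordD_mem p L M (by omega) x.2⟩ : C R A (-j)) := by
  simp only [coordCx, dif_pos hij]
  rfl

lemma relCC_d {i j : ℤ} (hij : i + 1 = j) (z : TotX R A (-i)) :
    (relCC R A p hML).d i j z = totD R A p L M (-i) (-j) (by omega) z := by
  simp only [relCC, dif_pos hij]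
  rfl

lemma toPair_d {i j : ℤ} (hij : i + 1 = j) (z : (relCC R A p hML).X i) :
    toPair ((relCC R A p hML).d i j z) = pairD p L M (toPair z) := by
  rw [relCC_d hij z]
  rfl

lemma toPair_injective {i : ℤ} :
    Function.Injective (toPair (R := R) (A := A) (p := p) (hML := hML) (i := i)) :=
  fun _ _ h => Prod.ext (Subtype.ext (Prod.ext_iff.mp h).1) (Subtype.ext (Prod.ext_iff.mp h).2)

lemma toPair_add {i : ℤ} (z z' : (relCC R A p hML).X i) :
    toPair (z + z') = toPair z + toPair z' := rfl

lemma toPair_smul {i : ℤ} (a : R) (z : (relCC R A p hML).X i) :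
    toPair (a • z) = a • toPair z := rfl

lemma toPair_mem {i : ℤ} (z : (relCC R A p hML).X i) :
    (toPair z).1 ∈ CC R A (-i) ∧ (toPair z).2 ∈ CC R A (-i + 1) := by
  let w : TotX R A (-i) := z
  exact ⟨w.1.2, w.2.2⟩

lemma exists_toPair {i n : ℤ} (hn : n = -i) {z : (ℕ → EForms R A) × (ℕ → EForms R A)}
    (h1 : z.1 ∈ CC R A n) (h2 : z.2 ∈ CC R A (n + 1)) :
    ∃ w : (relCC R A p hML).X i, toPair w = z := by
  subst hn
  exact ⟨((⟨z.1, h1⟩, ⟨z.2, h2⟩) : TotX R A (-i)), rfl⟩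

variable (R A p L M) in
/-- `Ψ` in the coordinates `(η, κ)`, in homological degree `n`. -/
noncomputable def coordPsiLin (n : ℤ) : C R A n →ₗ[R] TotX R A n where
  toFun x := (⟨coordFst R A p L M x, coordFst_mem p L M x.2⟩,
    ⟨coordSnd R A p M x, coordSnd_mem p M x.2⟩)
  map_add' x y := Prod.ext (Subtype.ext (by simp)) (Subtype.ext (by simp))
  map_smul' a x := Prod.ext (Subtype.ext (by simp)) (Subtype.ext (by simp))

variable (R A p hML) in
/-- `Ψ` in the coordinates `(η, κ)`. -/
noncomputable def coordPsi : coordCx R A p hML ⟶ relCC R A p hML where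
  f i := ModuleCat.ofHom (coordPsiLin R A p L M (-i))
  comm' i j hij := by
    have hij' : i + 1 = j := hij
    ext x : 2
    apply toPair_injective
    refine (toPair_d hij' (coordPsiLin R A p L M (-i) x)).trans (Eq.trans ?_ (congrArg
      (fun y : C R A (-j) => toPair (p := p) (hML := hML) (i := j) (coordPsiLin R A p L M (-j) y))
      (coordCx_d hij' x).symm))
    exact Prod.ext (DD_coordFst p hML x.1) (transCC_coordFst p hML x.1)

lemma toPair_coordPsi {i : ℤ} (x : C R A (-i)) :
    toPair ((coordPsi R A p hML).f i x) = (coordFst R A p L M x, coordSnd R A p M x) := rfl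

/-- The decomposition of `𝐂𝐂(A_L, A_M)` into the image of `Ψ` and a contractible complement. -/
lemma exists_decomposition {i j : ℤ} (hij : i + 1 = j) (z : (relCC R A p hML).X j) :
    ∃ (x : (coordCx R A p hML).X j) (k : (relCC R A p hML).X j) (k' : (relCC R A p hML).X i),
      toPair k ∈ Compl R A ∧ toPair k' ∈ Compl R A ∧
      z = (coordPsi R A p hML).f j x + k + (relCC R A p hML).d i j k' := by
  obtain ⟨x, hx, k, hk, k', hk', h1, h2, h⟩ :=
    compl_exists p L M (toPair_mem z).1 (toPair_mem z).2
  obtain ⟨w', rfl⟩ := exists_toPair (p := p) (hML := hML) (i := i) (by omega) h1 h2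
  -- `compl_exists` gives no degree bound for `k`; it has the right degree as a difference of
  -- elements of the complex.
  have hw : ∃ w : (relCC R A p hML).X j, toPair w = k := by
    refine ⟨z - (coordPsi R A p hML).f j (⟨x, hx⟩ : C R A (-j)) - (relCC R A p hML).d i j w', ?_⟩
    have e (a b c : (relCC R A p hML).X j) : toPair (a - b - c) = toPair a - toPair b - toPair c :=
      rfl
    rw [e, toPair_d hij, toPair_coordPsi, ← h]
    dsimp only
    abel
  obtain ⟨w, rfl⟩ := hw
  refine ⟨(⟨x, hx⟩ : C R A (-j)), w, w', hk, hk', toPair_injective ?_⟩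
  rw [toPair_add, toPair_add, toPair_d hij, toPair_coordPsi, ← h]

lemma decomposition_unique {i j : ℤ} (hij : i + 1 = j) {x : (coordCx R A p hML).X j}
    {k : (relCC R A p hML).X j} {k' : (relCC R A p hML).X i} (hk : toPair k ∈ Compl R A)
    (hk' : toPair k' ∈ Compl R A)
    (h : (coordPsi R A p hML).f j x + k + (relCC R A p hML).d i j k' = 0) :
    x = 0 ∧ k = 0 ∧ k' = 0 := by
  have h1 := congrArg toPair h
  rw [toPair_add, toPair_add, toPair_d hij, toPair_coordPsi x] at h1
  obtain ⟨a, b, c⟩ := compl_unique hk hk' h1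
  exact ⟨Subtype.ext a, toPair_injective b, toPair_injective c⟩

lemma coordPsi_d (i j : ℤ) (x : (coordCx R A p hML).X i) :
    (coordPsi R A p hML).f j ((coordCx R A p hML).d i j x) =
      (relCC R A p hML).d i j ((coordPsi R A p hML).f i x) := by
  rw [← ModuleCat.comp_apply, ← ModuleCat.comp_apply, (coordPsi R A p hML).comm]

lemma d_d_apply (K : CochainComplex (ModuleCat R) ℤ) (i j l : ℤ) (x : K.X i) :
    K.d j l (K.d i j x) = 0 := by
  rw [← ModuleCat.comp_apply, K.d_comp_d]
  rfl

variable (R A p hML) in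
-- Applying the differential to `Ψ(x) + k + 𝐝k'` gives `Ψ(dx) + 𝐝k`, which is again in decomposed
-- form, with `k` in the place of `k'`. Uniqueness then yields both surjectivity and injectivity on
-- homology.
lemma quasiIso_coordPsi : QuasiIso (coordPsi R A p hML) := by
  refine quasiIso_of_elements _ (fun i j l hij hjl z hz => ?_) fun i j hij x w hw => ?_
  · obtain ⟨x, k, k', hk, hk', rfl⟩ := exists_decomposition hij z
    rw [map_add, map_add, d_d_apply, add_zero, ← coordPsi_d] at hz
    -- For a cocycle, `dx = 0` and `k = 0`, so it is `Ψ` of a cocycle plus a boundary.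
    obtain ⟨hx, -, hk0⟩ := decomposition_unique hjl (k := 0) (k' := k) (zero_mem (Compl R A)) hk
      (by rw [add_zero, hz])
    exact ⟨x, k', hx, by rw [hk0, add_zero]⟩
  · obtain ⟨y, k, k', hk, hk', rfl⟩ := exists_decomposition (i := i - 1) (by ring) w
    rw [map_add, map_add, d_d_apply, add_zero, ← coordPsi_d] at hw
    obtain ⟨hx, -⟩ := decomposition_unique hij (x := x - (coordCx R A p hML).d i j y) (k := 0)
      (k' := -k) (zero_mem (Compl R A)) (neg_mem hk)
      (by rw [map_sub, hw, map_neg]; abel)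
    exact ⟨y, (sub_eq_zero.mp hx).symm⟩

end Complexes

/-! ### The coordinates of the cones; existence and uniqueness of `Ψ`. -/

section Coordinates
variable {R : Type*} {A : Type*} [CommRing R] [CommRing A] [Algebra R A]

lemma Om_eq_bot {s : ℤ} (hs : s < 0) : Om R A s = ⊥ := if_neg (by omega)

lemma mem_Om_neg {s : ℤ} (hs : s < 0) {x : Forms R A} (hx : x ∈ Om R A s) : x = 0 := by
  rwa [Om_eq_bot hs, Submodule.mem_bot] at hx

lemma fil_eq_bot (p : ℕ) {r : ℕ} (c : ℕ) {s : ℤ} (hs : r < s) : fil R A p r c s = ⊥ :=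
  if_neg (by omega)

lemma mem_fil {p r c N : ℕ} {s : ℤ} (h : s + N = r + 1) (hN : N ≠ 0) {x : Forms R A} :
    x ∈ fil R A p r c s ↔ ∃ y ∈ Om R A s, (p : R) ^ (N * c) • y = x := by
  have h1 : s ≤ r := by omega
  have h2 : ((r : ℤ) + 1 - s).toNat = N := by omega
  rw [fil, if_pos h1, h2, mem_pOm]

variable (R A) in
/-- The form `θ = p^{qL} η_q` in terms of the coordinates; zero for `q = 0`. -/
noncomputable def coordTheta (p L : ℕ) : ℕ → (EForms R A →ₗ[R] Forms R A)
  | 0 => 0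
  | q + 1 => (p : R) ^ ((q + 1) * L) • (LinearMap.proj q).comp (LinearMap.fst R _ _)

variable (R A) in
/-- The form `λ = p^{(q+1)M} κ_q` in terms of the coordinates. -/
noncomputable def coordLam (p M q : ℕ) : EForms R A →ₗ[R] Forms R A :=
  (p : R) ^ ((q + 1) * M) • (LinearMap.proj q).comp (LinearMap.snd R _ _)

lemma coordTheta_mem (p L : ℕ) {n s : ℤ} {r q : ℕ} (h : n = r + q) (hs : s = r - q + 1)
    {x : EForms R A} (hx : x ∈ C R A n) : coordTheta R A p L q x ∈ fil R A p r L s := by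
  cases q with
  | zero => exact zero_mem _
  | succ q =>
    rw [mem_fil (N := q + 1) (by omega) (by omega)]
    refine ⟨x.1 q, ?_, rfl⟩
    convert (hx q).1 using 1
    rw [hs, h]
    push_cast; ring_nf

lemma coordLam_mem (p M : ℕ) {n s : ℤ} {r q : ℕ} (h : n = r + q) (hs : s = r - q)
    {x : EForms R A} (hx : x ∈ C R A n) : coordLam R A p M q x ∈ fil R A p r M s := by
  rw [mem_fil (N := q + 1) (by omega) (by omega)]
  refine ⟨x.2 q, ?_, rfl⟩
  convert (hx q).2 using 1
  rw [hs, h]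
  ring_nf

variable (R A) in
/-- The component in the `r`-th cone of the element with given coordinates. -/
noncomputable def coordCone (p L M r : ℕ) (i : ℤ) :
    C R A (-i) →ₗ[R] ConeX R A p L M r (i + 2 * r) :=
  if h : (r : ℤ) ≤ -i then
    LinearMap.prod
      (((coordTheta R A p L (-i - r).toNat).comp (C R A (-i)).subtype).codRestrict
        (fil R A p r L (i + 2 * r + 1)) fun x => coordTheta_mem p L (by omega) (by omega) x.2)
      (((coordLam R A p M (-i - r).toNat).comp (C R A (-i)).subtype).codRestrict
        (fil R A p r M (i + 2 * r)) fun x => coordLam_mem p M (by omega) (by omega) x.2)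
  else 0

lemma coordCone_fst {p L M r : ℕ} {i : ℤ} (q : ℕ) (h : (r : ℤ) + q = -i) (x : C R A (-i)) :
    ((coordCone R A p L M r i x).1 : Forms R A) = coordTheta R A p L q x := by
  have h1 : (r : ℤ) ≤ -i := by omega
  have h2 : (-i - r).toNat = q := by omega
  rw [coordCone, dif_pos h1, ← h2]
  rfl

lemma coordCone_snd {p L M r : ℕ} {i : ℤ} (q : ℕ) (h : (r : ℤ) + q = -i) (x : C R A (-i)) :
    ((coordCone R A p L M r i x).2 : Forms R A) = coordLam R A p M q x := by
  have h1 : (r : ℤ) ≤ -i := by omega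
  have h2 : (-i - r).toNat = q := by omega
  rw [coordCone, dif_pos h1, ← h2]
  rfl

lemma mem_fil_of_lt {p r c : ℕ} {s : ℤ} (hs : r < s) {x : Forms R A}
    (hx : x ∈ fil R A p r c s) : x = 0 := by
  rwa [fil_eq_bot p c hs, Submodule.mem_bot] at hx

lemma coneX_eq_zero {p L M r : ℕ} {s : ℤ} (h : r < s) (c : ConeX R A p L M r s) : c = 0 :=
  Prod.ext (Subtype.ext (mem_fil_of_lt (by omega) c.1.2)) (Subtype.ext (mem_fil_of_lt h c.2.2))

lemma coneX_fst_eq_zero {p L M r : ℕ} {s : ℤ} (h : r ≤ s) (c : ConeX R A p L M r s) :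
    c.1 = 0 :=
  Subtype.ext (mem_fil_of_lt (by omega) c.1.2)

/-- In a fixed cone the differential lowers `q` by one. The factors in `coordD` are what remains
when the powers `p^{qL}` and `p^{(q+1)M}` for the two values of `q` are compared. -/
lemma coordCone_coordD {p L M : ℕ} (hML : M < L) (r : ℕ) {i j : ℤ} (hij : i + 1 = j)
    (x : C R A (-i)) (hx : coordD R A p L M x ∈ C R A (-j)) :
    coordCone R A p L M r j ⟨coordD R A p L M x, hx⟩ =
      coneD R A p hML r (i + 2 * r) (j + 2 * r) (by omega) (coordCone R A p L M r i x) := by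
  by_cases hr : (r : ℤ) < -i
  · obtain ⟨q, hq⟩ : ∃ q : ℕ, (r : ℤ) + q = -j := ⟨(-j - r).toNat, by omega⟩
    have hq' : (r : ℤ) + (q + 1 : ℕ) = -i := by push_cast; omega
    obtain ⟨e, rfl⟩ := Nat.exists_eq_add_of_le hML.le
    refine Prod.ext (Subtype.ext ?_) (Subtype.ext ?_)
    · rw [coordCone_fst q hq]
      simp only [coneD, LinearMap.coe_mk, AddHom.coe_mk, coordCone_fst (q + 1) hq']
      cases q with
      | zero =>
        -- Here `θ` lies in the top degree `r`, where the truncated differential is zero; this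
        -- agrees with `coordTheta` being zero for `q = 0`.
        rw [dTr, if_neg (by push_cast at hq'; omega)]
        simp [coordTheta]
      | succ q =>
        rw [dTr, if_pos (by push_cast at hq'; omega)]
        simp only [coordTheta, coordD, LinearMap.smul_apply, LinearMap.comp_apply,
          LinearMap.fst_apply, LinearMap.proj_apply, LinearMap.coe_mk, AddHom.coe_mk, smul_neg,
          smul_smul, ← pow_add, map_smul]
        congr 3
        ring
    · rw [coordCone_snd q hq]
      simp only [coneD, LinearMap.coe_mk, AddHom.coe_mk, coordCone_fst (q + 1) hq',
        coordCone_snd (q + 1) hq']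
      rw [dTr, if_pos (by push_cast at hq'; omega)]
      simp only [coordTheta, coordLam, coordD, LinearMap.smul_apply, LinearMap.comp_apply,
        LinearMap.fst_apply, LinearMap.snd_apply, LinearMap.proj_apply, LinearMap.coe_mk,
        AddHom.coe_mk, smul_add, smul_smul, ← pow_add, map_smul, Nat.add_sub_cancel_left]
      congr 3 <;> ring
  · rw [coneX_eq_zero (by omega) (coordCone R A p L M r j _)]
    have h1 := coneX_fst_eq_zero (by omega) (coordCone R A p L M r i x)
    refine Prod.ext (Subtype.ext ?_) (Subtype.ext ?_)
    · simp [coneD, h1]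
    · simp only [coneD, LinearMap.coe_mk, AddHom.coe_mk, h1]
      rw [dTr, if_neg (by omega)]
      simp

variable (R A) in
/-- The isomorphism of the coordinates with the source, in degree `i`. -/
noncomputable def coordSourceLin (p L M : ℕ) (i : ℤ) :
    C R A (-i) →ₗ[R] ⨁ r : ℕ, ConeX R A p L M r (i + 2 * r) :=
  ∑ r ∈ Finset.range ((-i).toNat + 1),
    (DirectSum.lof R ℕ (fun r : ℕ => ConeX R A p L M r (i + 2 * r)) r).comp
      (coordCone R A p L M r i)

lemma coordSourceLin_apply {p L M : ℕ} {i : ℤ} (x : C R A (-i)) (r : ℕ) :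
    coordSourceLin R A p L M i x r = coordCone R A p L M r i x := by
  simp only [coordSourceLin, LinearMap.sum_apply, LinearMap.comp_apply]
  rw [DFinsupp.finsetSum_apply]
  rw [Finset.sum_eq_single r]
  · exact DirectSum.lof_apply R r _
  · intro b _ hb
    exact DFinsupp.single_eq_of_ne hb.symm
  · intro hr
    rw [Finset.mem_range] at hr
    rw [coneX_eq_zero (by omega) (coordCone R A p L M r i x), map_zero]
    rfl

lemma lmap_coneD_coordSourceLin {p L M : ℕ} (hML : M < L) {i j : ℤ} (hij : i + 1 = j)
    (x : C R A (-i)) (hx : coordD R A p L M x ∈ C R A (-j)) :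
    DirectSum.lmap (fun r => coneD R A p hML r (i + 2 * r) (j + 2 * r) (by omega))
      (coordSourceLin R A p L M i x) = coordSourceLin R A p L M j ⟨coordD R A p L M x, hx⟩ := by
  refine DFinsupp.ext fun r => ?_
  rw [DirectSum.lmap_apply, coordSourceLin_apply, coordSourceLin_apply]
  exact (coordCone_coordD hML r hij x _).symm

variable {p : ℕ} {L M : ℕ} {hML : M < L}

lemma source_d {i j : ℤ} (hij : i + 1 = j) (x : ⨁ r : ℕ, ConeX R A p L M r (i + 2 * r)) :
    (source R A p hML).d i j x =
      DirectSum.lmap (fun r => coneD R A p hML r (i + 2 * r) (j + 2 * r) (by omega)) x := by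
  simp only [source, dif_pos hij]
  rfl

variable (R A p hML) in
/-- The morphism from the coordinates to the source. -/
noncomputable def coordSource : coordCx R A p hML ⟶ source R A p hML where
  f i := ModuleCat.ofHom (coordSourceLin R A p L M i)
  comm' i j hij := by
    have hij' : i + 1 = j := hij
    ext x : 2
    exact (source_d hij' (coordSourceLin R A p L M i x)).trans
      ((lmap_coneD_coordSourceLin hML hij' x _).trans (congrArg
        (fun y : C R A (-j) => coordSourceLin R A p L M j y) (coordCx_d hij' x).symm))

variable (R A) in
/-- The coordinates of the element of the `r`-th cone given by `η` and `κ`. -/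
noncomputable def coordSingle : ℕ → Forms R A → Forms R A → EForms R A
  | 0, _, κ => (0, Pi.single 0 κ)
  | q + 1, η, κ => (Pi.single q η, Pi.single (q + 1) κ)

lemma coordSingle_mem {n : ℤ} {r q : ℕ} (h : n = r + q) {η κ : Forms R A}
    (hη : η ∈ Om R A ((r : ℤ) - q + 1)) (hκ : κ ∈ Om R A ((r : ℤ) - q)) :
    coordSingle R A q η κ ∈ C R A n := by
  intro m
  have h2 : (Pi.single q κ : ℕ → Forms R A) m ∈ Om R A (n - 2 * m) := by
    by_cases hm : m = q
    · subst hm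
      rw [Pi.single_eq_same]
      convert hκ using 1
      rw [h]; ring_nf
    · rw [Pi.single_eq_of_ne hm]
      exact zero_mem _
  cases q with
  | zero => exact ⟨zero_mem _, h2⟩
  | succ q =>
    refine ⟨?_, h2⟩
    change (Pi.single q η : ℕ → Forms R A) m ∈ _
    by_cases hm : m = q
    · subst hm
      rw [Pi.single_eq_same]
      convert hη using 1
      rw [h]; push_cast; ring_nf
    · rw [Pi.single_eq_of_ne hm]
      exact zero_mem _

lemma coordTheta_coordSingle {q : ℕ} {η κ : Forms R A} (q' : ℕ) (h0 : q = 0 → η = 0) :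
    coordTheta R A p L q' (coordSingle R A q η κ) =
      if q' = q then (p : R) ^ (q * L) • η else 0 := by
  cases q' with
  | zero =>
    by_cases h : 0 = q
    · rw [if_pos h, h0 h.symm]; simp [coordTheta]
    · rw [if_neg h]; simp [coordTheta]
  | succ q' =>
    cases q with
    | zero => simp [coordTheta, coordSingle]
    | succ q =>
      by_cases h : q' = q
      · subst h; simp [coordTheta, coordSingle]
      · simp [coordTheta, coordSingle, h]

lemma coordLam_coordSingle {q : ℕ} {η κ : Forms R A} (q' : ℕ) :
    coordLam R A p M q' (coordSingle R A q η κ) =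
      if q' = q then (p : R) ^ ((q + 1) * M) • κ else 0 := by
  have : (coordSingle R A q η κ).2 = Pi.single q κ := by cases q <;> rfl
  by_cases h : q' = q
  · subst h; simp [coordLam, this]
  · simp [coordLam, this, h]

/-- Elements concentrated in one cone correspond to those with a single pair `(η_q, κ_q)`. The
condition `h0` is there because the coordinates have no slot for `η_0`. -/
lemma coordSourceLin_coordSingle {r q : ℕ} {i : ℤ} (hi : (r : ℤ) + q = -i)
    (c : ConeX R A p L M r (i + 2 * r)) {η κ : Forms R A} (h0 : q = 0 → η = 0)
    (hη : η ∈ Om R A ((r : ℤ) - q + 1)) (hκ : κ ∈ Om R A ((r : ℤ) - q))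
    (h1 : (c.1 : Forms R A) = (p : R) ^ (q * L) • η)
    (h2 : (c.2 : Forms R A) = (p : R) ^ ((q + 1) * M) • κ) :
    coordSourceLin R A p L M i ⟨coordSingle R A q η κ, coordSingle_mem hi.symm hη hκ⟩ =
      DirectSum.lof R ℕ (fun r : ℕ => ConeX R A p L M r (i + 2 * r)) r c := by
  refine DFinsupp.ext fun r' => ?_
  rw [coordSourceLin_apply]
  by_cases hr' : (r' : ℤ) ≤ -i
  · obtain ⟨q', hq'⟩ : ∃ q' : ℕ, (r' : ℤ) + q' = -i := ⟨(-i - r').toNat, by omega⟩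
    by_cases h : r' = r
    · subst h
      obtain rfl : q' = q := by omega
      rw [DirectSum.lof_apply]
      refine Prod.ext (Subtype.ext ?_) (Subtype.ext ?_)
      · rw [coordCone_fst q' hi, coordTheta_coordSingle _ h0, if_pos rfl, h1]
      · rw [coordCone_snd q' hi, coordLam_coordSingle, if_pos rfl, h2]
    · have hq : q' ≠ q := by omega
      rw [DirectSum.lof_eq_of, DirectSum.of_eq_of_ne _ _ _ h]
      refine Prod.ext (Subtype.ext ?_) (Subtype.ext ?_)
      · rw [coordCone_fst q' hq', coordTheta_coordSingle _ h0, if_neg hq]; rfl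
      · rw [coordCone_snd q' hq', coordLam_coordSingle, if_neg hq]; rfl
  · rw [coneX_eq_zero (by omega) (coordCone R A p L M r' i _)]
    rw [DirectSum.lof_eq_of, DirectSum.of_eq_of_ne _ _ _ (by omega)]

lemma epsTerm_fst (i m i' m' : ℕ) (α : Forms R A) :
    (epsTerm R A i m α i').1 m' = if i' = i ∧ m' = m then α else 0 := by
  by_cases hi : i' = i
  · subst hi
    by_cases hm : m' = m
    · subst hm; simp [epsTerm]
    · simp [epsTerm, hm]
  · simp [epsTerm, hi]

lemma epsTerm_snd (i m i' : ℕ) (α : Forms R A) : (epsTerm R A i m α i').2 = 0 := by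
  by_cases hi : i' = i
  · subst hi; simp [epsTerm]
  · simp [epsTerm, hi]

lemma plainTerm_fst (i m i' : ℕ) (β : Forms R A) : (plainTerm R A i m β i').1 = 0 := by
  by_cases hi : i' = i
  · subst hi; simp [plainTerm]
  · simp [plainTerm, hi]

lemma plainTerm_snd (i m i' m' : ℕ) (β : Forms R A) :
    (plainTerm R A i m β i').2 m' = if i' = i ∧ m' = m then β else 0 := by
  by_cases hi : i' = i
  · subst hi
    by_cases hm : m' = m
    · subst hm; simp [plainTerm]
    · simp [plainTerm, hm]
  · simp [plainTerm, hi]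

lemma sum_epsTerm_fst (p N q : ℕ) (α : Forms R A) (i m : ℕ) :
    ((∑ m ∈ Finset.Icc 1 q, ((-1 : R) ^ (m - 1) * (p : R) ^ ((q - m) * N)) •
      epsTerm R A (q - m) (m - 1) α) i).1 m =
      if i + m + 1 = q then ((-1 : R) ^ m * (p : R) ^ (i * N)) • α else 0 := by
  simp only [Finset.sum_apply, Prod.fst_sum, Pi.smul_apply, Prod.smul_fst, epsTerm_fst]
  split_ifs with h
  · rw [Finset.sum_eq_single (m + 1)]
    · rw [if_pos (by omega), show q - (m + 1) = i by omega, Nat.add_sub_cancel]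
    · intro b hb hne
      rw [Finset.mem_Icc] at hb
      rw [if_neg (by omega), smul_zero]
    · intro hm
      rw [Finset.mem_Icc] at hm
      omega
  · refine Finset.sum_eq_zero fun b hb => ?_
    rw [Finset.mem_Icc] at hb
    rw [if_neg (by omega), smul_zero]

lemma sum_epsTerm_snd (p N q : ℕ) (α : Forms R A) (i : ℕ) :
    ((∑ m ∈ Finset.Icc 1 q, ((-1 : R) ^ (m - 1) * (p : R) ^ ((q - m) * N)) •
      epsTerm R A (q - m) (m - 1) α) i).2 = 0 := by
  simp [Finset.sum_apply, Prod.snd_sum, epsTerm_snd]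

lemma coordSingle_fst (q : ℕ) (η κ : Forms R A) (m : ℕ) :
    (coordSingle R A q η κ).1 m = if m + 1 = q then η else 0 := by
  cases q with
  | zero => rfl
  | succ q =>
    by_cases h : m = q
    · subst h; simp [coordSingle]
    · simp [coordSingle, h]

lemma coordSingle_snd (q : ℕ) (η κ : Forms R A) (m : ℕ) :
    (coordSingle R A q η κ).2 m = if m = q then κ else 0 := by
  have : (coordSingle R A q η κ).2 = Pi.single q κ := by cases q <;> rfl
  rw [this, Pi.single_apply]

lemma coordFst_coordSingle (p L M q : ℕ) (η κ : Forms R A) :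
    coordFst R A p L M (coordSingle R A q η κ) =
      psiFst R A p L q η ((p : R) ^ ((q + 1) * M) • κ) := by
  ext i m
  · rw [psiFst, Pi.add_apply, Prod.fst_add, Pi.add_apply, sum_epsTerm_fst, plainTerm_fst]
    simp [coordFst, coordSingle_fst]
  · rw [psiFst, Pi.add_apply, Prod.snd_add, Pi.add_apply, sum_epsTerm_snd, plainTerm_snd]
    simp only [coordFst, LinearMap.coe_mk, AddHom.coe_mk, coordSingle_snd, Pi.zero_apply, zero_add]
    by_cases hi : i = q <;> by_cases hm : m = 0 <;> simp [hi, hm]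

lemma coordSnd_coordSingle (p M q : ℕ) (η κ : Forms R A) :
    coordSnd R A p M (coordSingle R A q η κ) = psiSnd R A p M q κ := by
  ext i m
  · rw [psiSnd, sum_epsTerm_fst]
    simp [coordSnd, coordSingle_snd]
  · rw [psiSnd, sum_epsTerm_snd]
    rfl

lemma pow_smul_eq_zero (htf : ∀ x : Forms R A, (p : R) • x = 0 → x = 0) (N : ℕ) {x : Forms R A}
    (hx : (p : R) ^ N • x = 0) : x = 0 := by
  induction N with
  | zero => simpa using hx
  | succ N ih =>
    rw [pow_succ', mul_smul] at hx
    exact ih (htf _ hx)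

/-- The cones see the coordinates only after multiplication by powers of `p`, which can be cancelled
in the absence of torsion. -/
lemma coordSourceLin_injective (htf : ∀ x : Forms R A, (p : R) • x = 0 → x = 0) (i : ℤ) :
    Function.Injective (coordSourceLin R A p L M i) := by
  rw [injective_iff_map_eq_zero]
  intro x hx
  have h (r : ℕ) : coordCone R A p L M r i x = 0 := by
    rw [← coordSourceLin_apply, hx]
    rfl
  refine Subtype.ext (Prod.ext (funext fun m => ?_) (funext fun m => ?_))
  · have hm := (x.2 m).1
    by_cases hs : -i - 2 * (m : ℤ) - 1 < 0
    · exact mem_Om_neg hs hm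
    -- The coordinate `x.1 m` is `η_q` for `q = m + 1`, hence `r = -i - q`, which is nonnegative
    -- when the degree of the form is.
    · have h1 := coordCone_fst (p := p) (L := L) (M := M) (r := (-i - m - 1).toNat) (m + 1)
        (by push_cast; omega) x
      rw [h] at h1
      exact pow_smul_eq_zero htf _ h1.symm
  · have hm := (x.2 m).2
    by_cases hs : -i - 2 * (m : ℤ) < 0
    · exact mem_Om_neg hs hm
    · have h1 := coordCone_snd (p := p) (L := L) (M := M) (r := (-i - m).toNat) m (by omega) x
      rw [h] at h1
      exact pow_smul_eq_zero htf _ h1.symm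

lemma exists_coneX_coords {r q : ℕ} {s : ℤ} (hs : s = r - q) (c : ConeX R A p L M r s) :
    ∃ η ∈ Om R A ((r : ℤ) - q + 1), ∃ κ ∈ Om R A ((r : ℤ) - q), (q = 0 → η = 0) ∧
      (c.1 : Forms R A) = (p : R) ^ (q * L) • η ∧
      (c.2 : Forms R A) = (p : R) ^ ((q + 1) * M) • κ := by
  subst hs
  obtain ⟨κ, hκ, hc2⟩ := (mem_fil (N := q + 1) (by push_cast; omega) (by omega)).mp c.2.2
  by_cases hq : q = 0
  · have h1 := coneX_fst_eq_zero (by omega) c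
    exact ⟨0, zero_mem _, κ, hκ, fun _ => rfl, by rw [h1, smul_zero]; rfl, hc2.symm⟩
  · obtain ⟨η, hη, hc1⟩ := (mem_fil (N := q) (by omega) hq).mp c.1.2
    exact ⟨η, hη, κ, hκ, fun h => absurd h hq, hc1.symm, hc2.symm⟩

lemma coordSourceLin_surjective (i : ℤ) : Function.Surjective (coordSourceLin R A p L M i) := by
  rw [← LinearMap.range_eq_top, eq_top_iff]
  rintro y -
  induction y using DirectSum.induction_on with
  | zero => exact zero_mem _
  | add a b ha hb => exact add_mem ha hb
  | of r c =>
    by_cases hr : (r : ℤ) ≤ -i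
    · obtain ⟨q, hq⟩ : ∃ q : ℕ, (r : ℤ) + q = -i := ⟨(-i - r).toNat, by omega⟩
      obtain ⟨η, hη, κ, hκ, h0, h1, h2⟩ := exists_coneX_coords (q := q) (by omega) c
      exact ⟨_, coordSourceLin_coordSingle hq c h0 hη hκ h1 h2⟩
    · rw [coneX_eq_zero (by omega) c, map_zero]
      exact zero_mem _

lemma isIso_coordSource (htf : ∀ x : Forms R A, (p : R) • x = 0 → x = 0) :
    IsIso (coordSource R A p hML) := by
  have (i : ℤ) : IsIso ((coordSource R A p hML).f i) := by
    rw [ConcreteCategory.isIso_iff_bijective]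
    exact ⟨coordSourceLin_injective htf i, coordSourceLin_surjective i⟩
  exact HomologicalComplex.Hom.isIso_of_components _

lemma isPsi_of_coordSource_comp {Ψ : source R A p hML ⟶ relCC R A p hML}
    (h : coordSource R A p hML ≫ Ψ = coordPsi R A p hML) : IsPsi Ψ := by
  intro r q c η hη κ hκ h1 h2
  -- For `q = 0`, `θ` has degree `r + 1`, beyond the truncation, and the power of `p` in front of
  -- `η` is `1`.
  have hη0 : q = 0 → η = 0 := by
    rintro rfl
    have := coneX_fst_eq_zero (by push_cast; omega) c
    rw [this] at h1
    simpa using h1.symm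
  have hx := coordSourceLin_coordSingle (i := -((r + q : ℕ) : ℤ)) (by push_cast; ring) c hη0 hη hκ
    h1 h2
  have hc : inCone hML r (-((r + q : ℕ) : ℤ)) c = (coordSource R A p hML).f _ _ := hx.symm
  have hcomp (i : ℤ) (x : (coordCx R A p hML).X i) :
      Ψ.f i ((coordSource R A p hML).f i x) = (coordPsi R A p hML).f i x := by
    rw [← ModuleCat.comp_apply, ← HomologicalComplex.comp_f, h]
  rw [hc]
  refine (congrArg toPair (hcomp _ _)).trans ((toPair_coordPsi _).trans ?_)
  rw [coordFst_coordSingle, coordSnd_coordSingle]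

/-- Every element of a nonzero cone term can be written with some `η` and `κ`, so the formula
prescribes all values. -/
lemma IsPsi.eq {Ψ Ψ' : source R A p hML ⟶ relCC R A p hML} (h : IsPsi Ψ) (h' : IsPsi Ψ') :
    Ψ = Ψ' := by
  ext i : 1
  ext : 1
  refine DirectSum.linearMap_ext R fun r => LinearMap.ext fun c => ?_
  change Ψ.f i (inCone hML r i c) = Ψ'.f i (inCone hML r i c)
  by_cases hr : (r : ℤ) ≤ -i
  · obtain ⟨q, hq⟩ : ∃ q : ℕ, (r : ℤ) + q = -i := ⟨(-i - r).toNat, by omega⟩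
    obtain rfl : i = -((r + q : ℕ) : ℤ) := by push_cast; omega
    obtain ⟨η, hη, κ, hκ, -, h1, h2⟩ := exists_coneX_coords (q := q) (by push_cast; omega) c
    apply toPair_injective
    rw [h r q c η hη κ hκ h1 h2, h' r q c η hη κ hκ h1 h2]
  · have : inCone hML r i c = 0 := by
      rw [coneX_eq_zero (by omega) c]
      exact map_zero _
    rw [this, map_zero, map_zero]

/-- `Ψ` is obtained by transporting `coordPsi` along the isomorphism `coordSource`, so it is a chain
map and independent of the choice of `η` and `κ`. -/
lemma existsUnique_isPsi (htf : ∀ x : Forms R A, (p : R) • x = 0 → x = 0) :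
    ∃! Ψ : source R A p hML ⟶ relCC R A p hML, IsPsi Ψ := by
  have := isIso_coordSource (hML := hML) htf
  exact ⟨inv (coordSource R A p hML) ≫ coordPsi R A p hML,
    isPsi_of_coordSource_comp (by simp), fun Ψ h => h.eq
      (isPsi_of_coordSource_comp (by simp))⟩

lemma IsPsi.quasiIso (htf : ∀ x : Forms R A, (p : R) • x = 0 → x = 0)
    {Ψ : source R A p hML ⟶ relCC R A p hML} (h : IsPsi Ψ) : QuasiIso Ψ := by
  have := isIso_coordSource (hML := hML) htf
  have := quasiIso_coordPsi R A p hML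
  rw [h.eq (isPsi_of_coordSource_comp (Ψ := inv (coordSource R A p hML) ≫ coordPsi R A p hML)
    (by simp))]
  infer_instance

end Coordinates

/-! ### Homology of the cones and the description of `𝐇𝐂_n`. -/

section SourceHomology

/-- Two surjections with the same kernel have isomorphic targets. All subtractions take place in `X`
and `Y`, so `Q` may be a direct sum known only as an additive monoid. -/
lemma exists_addEquiv_of_ker_eq {X Y Q : Type*} [AddCommGroup X] [AddCommGroup Y]
    [AddCommMonoid Q] {f : X →+ Y} {g : X →+ Q}
    (hf : Function.Surjective f) (hg : Function.Surjective g) (h : ∀ x, f x = 0 ↔ g x = 0) :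
    ∃ e : Q ≃+ Y, ∀ x, e (g x) = f x := by
  have h1 {x y : X} (hxy : g x = g y) : f x = f y := by
    rw [← sub_eq_zero, ← map_sub, h, sub_eq_add_neg, map_add, hxy, ← map_add, add_neg_cancel,
      map_zero]
  have h2 {x y : X} (hxy : f x = f y) : g x = g y := by
    rw [← sub_eq_zero, ← map_sub, h] at hxy
    rw [← sub_add_cancel x y, map_add, hxy, zero_add]
  choose s hs using hg
  have hfs (x : X) : f (s (g x)) = f x := h1 (hs _)
  refine ⟨AddEquiv.ofBijective (AddMonoidHom.mk' (fun q => f (s q)) fun a b => ?_) ⟨?_, ?_⟩, hfs⟩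
  · rw [← map_add]
    exact h1 (by rw [hs, map_add, hs, hs])
  · intro a b hab
    rw [← hs a, ← hs b]
    exact h2 hab
  · intro y
    obtain ⟨x, rfl⟩ := hf y
    exact ⟨g x, hfs x⟩

lemma exists_linearEquiv_of_ker_eq {R X Y Q : Type*} [CommRing R] [AddCommGroup X]
    [AddCommGroup Y] [AddCommMonoid Q] [Module R X] [Module R Y] [Module R Q] {f : X →ₗ[R] Y}
    {g : X →ₗ[R] Q} (hf : Function.Surjective f) (hg : Function.Surjective g)
    (h : ∀ x, f x = 0 ↔ g x = 0) : ∃ e : Q ≃ₗ[R] Y, ∀ x, e (g x) = f x := by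
  obtain ⟨e, he⟩ := exists_addEquiv_of_ker_eq (f := f.toAddMonoidHom) (g := g.toAddMonoidHom)
    hf hg h
  refine ⟨e.toLinearEquiv fun a q => ?_, he⟩
  obtain ⟨x, rfl⟩ := hg q
  rw [← map_smul]
  exact (he (a • x)).trans ((map_smul f a x).trans (congrArg (a • ·) (he x).symm))

variable {R : Type*} {A : Type*} [CommRing R] [CommRing A] [Algebra R A]
variable {p : ℕ} {L M : ℕ} {hML : M < L} {n : ℕ}

lemma fil_eq_pOm {p r c N : ℕ} {s t : ℤ} (h : s + N = r + 1) (hN : N ≠ 0) (ht : s = t) :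
    fil R A p r c s = pOm R A p (N * c) t := by
  subst ht
  rw [fil, if_pos (by omega), show ((r : ℤ) + 1 - s).toNat = N by omega]

lemma dTr_mem_fil_of_mem_hcNum {r j : ℕ} (h : r + j = n) (ω : hcNum R A p L M n j) :
    dTr R A r (-(n : ℤ) + 2 * r) ω ∈ fil R A p r L (-(n : ℤ) + 2 * r + 1) := by
  rw [dTr]
  split_ifs with hs
  · rw [fil_eq_pOm (N := j) (t := (n : ℤ) - 2 * j + 1) (by omega) (by omega) (by omega)]
    exact ω.2.2
  · exact zero_mem _

variable (R A p L M) in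
/-- The cocycle `(-dω, ω)` of the `r`-th cone. -/
noncomputable def hcCone {r j : ℕ} (h : r + j = n) :
    hcNum R A p L M n j →ₗ[R] ConeX R A p L M r (-(n : ℤ) + 2 * r) :=
  LinearMap.prod
    (((-dTr R A r (-(n : ℤ) + 2 * r)).comp (hcNum R A p L M n j).subtype).codRestrict _
      fun ω => neg_mem (dTr_mem_fil_of_mem_hcNum h ω))
    ((hcNum R A p L M n j).subtype.codRestrict _ fun ω => by
      rw [fil_eq_pOm (N := j + 1) (t := (n : ℤ) - 2 * j) (by push_cast; omega) (by omega)
        (by omega)]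
      exact ω.2.1)

lemma hcCone_fst {r j : ℕ} (h : r + j = n) (ω : hcNum R A p L M n j) :
    ((hcCone R A p L M h ω).1 : Forms R A) = -dTr R A r (-(n : ℤ) + 2 * r) ω := rfl

lemma hcCone_snd {r j : ℕ} (h : r + j = n) (ω : hcNum R A p L M n j) :
    ((hcCone R A p L M h ω).2 : Forms R A) = ω := rfl

lemma coneD_hcCone {r j : ℕ} (h : r + j = n) {t : ℤ} (hst : -(n : ℤ) + 2 * r + 1 = t)
    (ω : hcNum R A p L M n j) :
    coneD R A p hML r _ t hst (hcCone R A p L M h ω) = 0 := by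
  refine Prod.ext (Subtype.ext ?_) (Subtype.ext ?_)
  · change -dTr R A r _ (-dTr R A r (-(n : ℤ) + 2 * r) ω) = 0
    rw [map_neg, dTr_dTr, neg_zero, neg_zero]
  · exact neg_add_cancel _

/-- The second component of the cocycle condition says `θ = -dλ`, and `θ ∈ p^{jL} Ω` is then the
condition on `dω`. -/
lemma exists_hcCone_eq {r j : ℕ} (h : r + j = n) {t : ℤ} (hst : -(n : ℤ) + 2 * r + 1 = t)
    {c : ConeX R A p L M r (-(n : ℤ) + 2 * r)} (hc : coneD R A p hML r _ t hst c = 0) :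
    ∃ ω, hcCone R A p L M h ω = c := by
  have h2 : (c.1 : Forms R A) + dTr R A r (-(n : ℤ) + 2 * r) c.2 = 0 :=
    congrArg (fun c => (c.2 : Forms R A)) hc
  have h3 := eq_neg_of_add_eq_zero_left h2
  refine ⟨⟨c.2, ?_, ?_⟩, Prod.ext (Subtype.ext h3.symm) rfl⟩
  · rw [← fil_eq_pOm (r := r) (s := -(n : ℤ) + 2 * r) (by push_cast; omega) (by omega) (by omega)]
    exact c.2.2
  · change Forms.d R A c.2 ∈ pOm R A p (j * L) _
    -- For `j = 0` the form has top degree `r`, where the truncated differential is zero and says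
    -- nothing about `dω`; but then the condition `dω ∈ p^0 Ω` is empty.
    by_cases hj : j = 0
    · subst hj
      have := c.2.2
      rw [mem_fil (N := 1) (by push_cast; omega) (by omega)] at this
      obtain ⟨y, hy, hy'⟩ := this
      rw [← hy', map_smul]
      refine Submodule.smul_mem _ _ ?_
      rw [mem_pOm]
      exact ⟨_, d_mem_Om R A (by push_cast; omega) hy, by simp⟩
    · rw [← fil_eq_pOm (r := r) (s := -(n : ℤ) + 2 * r + 1) (by omega) (by omega) (by omega)]
      rw [dTr, if_pos (by omega)] at h3
      rw [← neg_mem_iff, ← h3]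
      exact c.1.2

/-- It suffices to hit the second component, `ω = θ + dλ`; the first then follows from `d² = 0`.
Since `s + 1 = r - j ≤ r`, the differential on `λ` is not truncated. -/
lemma exists_coneD_eq_hcCone_iff {r j : ℕ} (h : r + j = n) {s : ℤ} (hst : s + 1 = -(n : ℤ) + 2 * r)
    (ω : hcNum R A p L M n j) :
    (∃ c, coneD R A p hML r s _ hst c = hcCone R A p L M h ω) ↔
      (ω : Forms R A) ∈ hcDen R A p L M n j := by
  have hd : dTr R A r s = Forms.d R A := by rw [dTr, if_pos (by omega)]
  constructor
  · rintro ⟨c, hc⟩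
    have h2 : (c.1 : Forms R A) + dTr R A r s c.2 = ω := congrArg (fun c => (c.2 : Forms R A)) hc
    rw [← h2, hd]
    refine Submodule.add_mem_sup ?_ ⟨_, ?_, rfl⟩
    · rw [← fil_eq_pOm (r := r) (s := s + 1) (by push_cast; omega) (by omega) (by omega)]
      exact c.1.2
    · change (c.2 : Forms R A) ∈ pOm R A p ((j + 2) * M) _
      rw [← fil_eq_pOm (r := r) (s := s) (by push_cast; omega) (by omega) (by omega)]
      exact c.2.2
  · intro hω
    obtain ⟨θ, hθ, _, ⟨l, hl, rfl⟩, hsum⟩ := Submodule.mem_sup.mp hω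
    rw [← fil_eq_pOm (r := r) (s := s + 1) (by push_cast; omega) (by omega) (by omega)] at hθ
    have hl' : l ∈ fil R A p r M s := by
      rw [fil_eq_pOm (N := j + 2) (t := (n : ℤ) - 2 * j - 1) (by push_cast; omega) (by omega)
        (by omega)]
      exact hl
    refine ⟨(⟨θ, hθ⟩, ⟨l, hl'⟩), Prod.ext (Subtype.ext ?_) (Subtype.ext ?_)⟩
    · rw [hcCone_fst, ← hsum, ← hd, map_add, dTr_dTr, add_zero]
      change -dTr R A r (s + 1) θ = _
      rw [hst]
    · rw [hcCone_snd, ← hsum, ← hd]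
      rfl

variable (R A p L M n) in
/-- The component in the `r`-th cone of the cocycle `(-dω, ω)`. -/
noncomputable def hcConeLin (r : ℕ) :
    (⨁ j : ℕ, hcNum R A p L M n j) →ₗ[R] ConeX R A p L M r (-(n : ℤ) + 2 * r) :=
  if h : r ≤ n then (hcCone R A p L M (Nat.add_sub_of_le h)).comp
    (DirectSum.component R ℕ _ (n - r)) else 0

lemma hcConeLin_apply {r j : ℕ} (h : r + j = n) (x : ⨁ j : ℕ, hcNum R A p L M n j) :
    hcConeLin R A p L M n r x = hcCone R A p L M h (x j) := by
  obtain rfl : j = n - r := by omega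
  rw [hcConeLin, dif_pos (by omega)]
  rfl

variable (R A p L M n) in
/-- The cocycle `(-dω, ω)` of the source. -/
noncomputable def hcSource : (⨁ j : ℕ, hcNum R A p L M n j) →ₗ[R]
    ⨁ r : ℕ, ConeX R A p L M r (-(n : ℤ) + 2 * r) :=
  ∑ r ∈ Finset.range (n + 1),
    (DirectSum.lof R ℕ (fun r : ℕ => ConeX R A p L M r (-(n : ℤ) + 2 * r)) r).comp
      (hcConeLin R A p L M n r)

lemma hcSource_apply (x : ⨁ j : ℕ, hcNum R A p L M n j) (r : ℕ) :
    hcSource R A p L M n x r = hcConeLin R A p L M n r x := by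
  simp only [hcSource, LinearMap.sum_apply, LinearMap.comp_apply]
  rw [DFinsupp.finsetSum_apply, Finset.sum_eq_single r]
  · exact DirectSum.lof_apply R r _
  · intro b _ hb
    exact DFinsupp.single_eq_of_ne hb.symm
  · intro hr
    rw [Finset.mem_range] at hr
    rw [coneX_eq_zero (by omega) (hcConeLin R A p L M n r x), map_zero]
    rfl

lemma hcSource_lof {r j : ℕ} (h : r + j = n) (ω : hcNum R A p L M n j) :
    hcSource R A p L M n (DirectSum.lof R ℕ (fun j => hcNum R A p L M n j) j ω) =
      DirectSum.lof R ℕ (fun r : ℕ => ConeX R A p L M r (-(n : ℤ) + 2 * r)) r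
        (hcCone R A p L M h ω) := by
  refine DFinsupp.ext fun r' => ?_
  rw [hcSource_apply]
  by_cases hr' : r' ≤ n
  · rw [hcConeLin_apply (Nat.add_sub_of_le hr')]
    by_cases hr : r' = r
    · subst hr
      obtain rfl : j = n - r' := by omega
      rw [DirectSum.lof_apply, DirectSum.lof_apply]
    · rw [DirectSum.lof_eq_of, DirectSum.of_eq_of_ne _ _ _ (by omega : n - r' ≠ j), map_zero,
        DirectSum.lof_eq_of, DirectSum.of_eq_of_ne _ _ _ hr]
  · rw [hcConeLin, dif_neg hr', DirectSum.lof_eq_of R ℕ (fun r : ℕ => ConeX R A p L M r _),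
      DirectSum.of_eq_of_ne _ _ _ (by omega : r' ≠ r)]
    rfl

lemma lmap_coneD_hcSource {j : ℤ} (hj : -(n : ℤ) + 1 = j) (x : ⨁ j : ℕ, hcNum R A p L M n j) :
    DirectSum.lmap (fun r => coneD R A p hML r (-(n : ℤ) + 2 * r) (j + 2 * r) (by omega))
      (hcSource R A p L M n x) = 0 := by
  refine DFinsupp.ext fun r => ?_
  rw [DirectSum.lmap_apply, hcSource_apply]
  by_cases hr : r ≤ n
  · rw [hcConeLin_apply (Nat.add_sub_of_le hr)]
    exact coneD_hcCone (hML := hML) (Nat.add_sub_of_le hr) (by omega) (x (n - r))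
  · rw [coneX_eq_zero (by omega) (hcConeLin R A p L M n r x), map_zero]
    rfl

lemma exists_hcSource_eq {j : ℤ} (hj : -(n : ℤ) + 1 = j)
    (z : ⨁ r : ℕ, ConeX R A p L M r (-(n : ℤ) + 2 * r))
    (hz : DirectSum.lmap (fun r => coneD R A p hML r (-(n : ℤ) + 2 * r) (j + 2 * r) (by omega))
      z = 0) : ∃ x, hcSource R A p L M n x = z := by
  have hω (m : ℕ) : ∃ ω : hcNum R A p L M n m, ∀ r (h : r + m = n),
      hcCone R A p L M h ω = z r := by
    by_cases hm : m ≤ n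
    · have h1 : coneD R A p hML (n - m) _ (j + 2 * (n - m : ℕ)) (by omega) (z (n - m)) = 0 := by
        rw [← DirectSum.lmap_apply
          (fun r => coneD R A p hML r (-(n : ℤ) + 2 * r) (j + 2 * r) (by omega)), hz]
        rfl
      obtain ⟨ω, hω⟩ := exists_hcCone_eq (Nat.sub_add_cancel hm) (by omega) h1
      refine ⟨ω, fun r h => ?_⟩
      obtain rfl : r = n - m := by omega
      exact hω
    · exact ⟨0, fun r h => by omega⟩
  choose ω hω using hω
  refine ⟨DirectSum.mk _ (Finset.range (n + 1)) fun m => ω m, DFinsupp.ext fun r => ?_⟩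
  rw [hcSource_apply]
  by_cases hr : r ≤ n
  · rw [hcConeLin_apply (Nat.add_sub_of_le hr), DirectSum.mk_apply_of_mem (Finset.mem_range.mpr (by omega)), hω]
  · rw [coneX_eq_zero (by omega) (hcConeLin R A p L M n r _), coneX_eq_zero (by omega) (z r)]

lemma exists_lmap_coneD_eq_hcSource_iff {i : ℤ} (hi : i + 1 = -(n : ℤ))
    (x : ⨁ j : ℕ, hcNum R A p L M n j) :
    (∃ w, DirectSum.lmap (fun r => coneD R A p hML r (i + 2 * r) (-(n : ℤ) + 2 * r) (by omega))
      w = hcSource R A p L M n x) ↔ ∀ j, (x j : Forms R A) ∈ hcDen R A p L M n j := by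
  constructor
  · rintro ⟨w, hw⟩ j
    by_cases hj : j ≤ n
    · refine (exists_coneD_eq_hcCone_iff (hML := hML) (Nat.sub_add_cancel hj)
        (s := i + 2 * (n - j : ℕ)) (by omega) (x j)).mp ⟨w (n - j), ?_⟩
      have := congrFun (congrArg DFunLike.coe hw) (n - j)
      rwa [DirectSum.lmap_apply, hcSource_apply, hcConeLin_apply (Nat.sub_add_cancel hj)] at this
    -- For `j > n` the form has negative degree `n - 2j`, hence is zero.
    · have h1 := (x j).2.1
      obtain ⟨y, hy, hy'⟩ := h1
      rw [← hy', mem_Om_neg (by omega) hy, map_zero]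
      exact zero_mem _
  · intro h
    have hw (r : ℕ) : ∃ c : ConeX R A p L M r (i + 2 * r),
        coneD R A p hML r (i + 2 * r) (-(n : ℤ) + 2 * r) (by omega) c =
          hcConeLin R A p L M n r x := by
      by_cases hr : r ≤ n
      · rw [hcConeLin_apply (Nat.add_sub_of_le hr)]
        exact (exists_coneD_eq_hcCone_iff (hML := hML) (Nat.add_sub_of_le hr)
          (by omega) (x (n - r))).mpr (h _)
      · exact ⟨0, by rw [coneX_eq_zero (by omega) (hcConeLin R A p L M n r x), map_zero]⟩
    choose w hw using hw
    refine ⟨DirectSum.mk _ (Finset.range (n + 1)) fun r => w r, DFinsupp.ext fun r => ?_⟩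
    rw [DirectSum.lmap_apply, hcSource_apply, ← hw]
    by_cases hr : r ≤ n
    · rw [DirectSum.mk_apply_of_mem (Finset.mem_range.mpr (by omega))]
    · rw [hw, coneX_eq_zero (by omega) (hcConeLin R A p L M n r x),
        DirectSum.mk_apply_of_notMem (by rw [Finset.mem_range]; omega), map_zero]

/-- The cocycles `(-dω, ω)` map onto the homology, and onto the sum of the quotients; both maps have
kernel `⨁ hcDen`. -/
lemma exists_source_homology_equiv (n : ℕ) :
    ∃ e : (⨁ j : ℕ, HCSummand R A p L M n j) ≃ₗ[R] (source R A p hML).homology (-(n : ℤ)),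
      ∀ (r j : ℕ) (h : r + j = n) (ω : hcNum R A p L M n j),
        Represents (inCone hML r (-(n : ℤ)) (hcCone R A p L M h ω))
          (e (DirectSum.lof R ℕ (fun j => HCSummand R A p L M n j) j
            (Submodule.Quotient.mk ω))) := by
  obtain ⟨f, hf, hr, hk⟩ := exists_linearMap_represents (K := source R A p hML)
    (i := -(n : ℤ) - 1) (j := -n) (l := -n + 1) (by ring) rfl (hcSource R A p L M n)
    (fun x => (source_d rfl (hcSource R A p L M n x)).trans (lmap_coneD_hcSource rfl x))
    (fun z hz => by
      obtain ⟨x, hx⟩ := exists_hcSource_eq rfl z ((source_d rfl z).symm.trans hz)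
      exact ⟨x, 0, hx.symm.trans (by rw [map_zero]; exact (add_zero _).symm)⟩)
  let g : (⨁ j : ℕ, hcNum R A p L M n j) →ₗ[R] ⨁ j : ℕ, HCSummand R A p L M n j :=
    DirectSum.lmap fun j => Submodule.mkQ _
  have hg : Function.Surjective g := by
    rw [← LinearMap.range_eq_top, eq_top_iff]
    rintro y -
    induction y using DirectSum.induction_on with
    | zero => exact zero_mem _
    | add a b ha hb => exact add_mem ha hb
    | of j c =>
      obtain ⟨ω, rfl⟩ := Submodule.Quotient.mk_surjective _ c
      exact ⟨DirectSum.lof R ℕ _ j ω, DirectSum.lmap_lof _ _ _⟩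
  have hfg (x) : f x = 0 ↔ g x = 0 := by
    have h1 : (∃ w, (source R A p hML).d (-(n : ℤ) - 1) (-n) w = hcSource R A p L M n x) ↔
        ∀ j, (x j : Forms R A) ∈ hcDen R A p L M n j := by
      rw [← exists_lmap_coneD_eq_hcSource_iff (hML := hML) (i := -(n : ℤ) - 1) (by ring)]
      exact exists_congr fun w => by rw [← source_d (by ring) w]; rfl
    refine (hk x).trans (h1.trans ?_)
    rw [DFinsupp.ext_iff]
    refine forall_congr' fun j => ?_
    rw [DirectSum.lmap_apply]
    exact (Submodule.Quotient.mk_eq_zero ((hcDen R A p L M n j).submoduleOf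
      (hcNum R A p L M n j)) (x := x j)).symm
  obtain ⟨e, he⟩ :=
    @exists_linearEquiv_of_ker_eq R (⨁ j : ℕ, hcNum R A p L M n j)
      ((source R A p hML).homology (-(n : ℤ))) (⨁ j : ℕ, HCSummand R A p L M n j)
      _ _ _ _ _ _ _ f g hf hg hfg
  refine ⟨e, fun r j h ω => ?_⟩
  have h1 : g (DirectSum.lof R ℕ _ j ω) = DirectSum.lof R ℕ
      (fun j => HCSummand R A p L M n j) j (Submodule.Quotient.mk ω) := DirectSum.lmap_lof _ _ _
  have h2 : inCone hML r (-(n : ℤ)) (hcCone R A p L M h ω) =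
      hcSource R A p L M n (DirectSum.lof R ℕ _ j ω) := (hcSource_lof h ω).symm
  rw [← h1, he, h2]
  exact hr _

lemma IsPsi.exists_homology_equiv (htf : ∀ x : Forms R A, (p : R) • x = 0 → x = 0)
    {Ψ : source R A p hML ⟶ relCC R A p hML} (hΨ : IsPsi Ψ) (n : ℕ) :
    ∃ e : (⨁ j : ℕ, HCSummand R A p L M n j) ≃ₗ[R] HC R A p hML n,
      ∀ r j : ℕ, r + j = n → ∀ (ω : hcNum R A p L M n j)
        (c : ConeX R A p L M r (-(n : ℤ) + 2 * r)),
        (c.1 : Forms R A) = -dTr R A r ((n : ℤ) - 2 * j) ω → (c.2 : Forms R A) = ω →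
        Represents (Ψ.f _ (inCone hML r _ c))
          (e (DirectSum.lof R ℕ (fun j => HCSummand R A p L M n j) j
            (Submodule.Quotient.mk ω))) := by
  have := hΨ.quasiIso htf
  obtain ⟨e, he⟩ := exists_source_homology_equiv (R := R) (A := A) (p := p) (hML := hML) n
  refine ⟨e.trans (asIso (HomologicalComplex.homologyMap Ψ (-(n : ℤ)))).toLinearEquiv,
    fun r j h ω c h1 h2 => ?_⟩
  have hc : c = hcCone R A p L M h ω := by
    refine Prod.ext (Subtype.ext (h1.trans ?_)) (Subtype.ext h2)
    rw [show (n : ℤ) - 2 * j = -(n : ℤ) + 2 * r by omega]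
    rfl
  rw [hc]
  exact (he r j h ω).map Ψ

end SourceHomology

/-! ### Homology modulo `p` in terms of reduced forms. -/

section ModP

section
variable {R : Type*} [CommRing R] {p : ℕ} {K : CochainComplex (ModuleCat R) ℤ}

lemma toModP_eq_zero_iff {i : ℤ} {z : K.X i} : toModP p z = 0 ↔ ∃ w, (p : R) • w = z :=
  Submodule.Quotient.mk_eq_zero _

lemma toModP_surjective {i : ℤ} : Function.Surjective (toModP p (K := K) (i := i)) :=
  Submodule.mkQ_surjective _

lemma toModP_add {i : ℤ} (z w : K.X i) : toModP p (z + w) = toModP p z + toModP p w :=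
  map_add _ _ _

lemma toModP_smul_self {i : ℤ} (z : K.X i) : toModP p ((p : R) • z) = 0 :=
  toModP_eq_zero_iff.mpr ⟨z, rfl⟩

lemma toModP_eq_iff {i : ℤ} {z w : K.X i} :
    toModP p z = toModP p w ↔ ∃ u, z = w + (p : R) • u := by
  rw [← sub_eq_zero]
  refine (toModP_eq_zero_iff (z := z - w)).trans (exists_congr fun u => ?_)
  rw [eq_sub_iff_add_eq, eq_comm, add_comm]

lemma modP_d {i j : ℤ} (z : K.X i) : (modP p K).d i j (toModP p z) = toModP p (K.d i j z) := rfl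

end

variable {R : Type*} {A : Type*} [CommRing R] [CommRing A] [Algebra R A]
variable {p : ℕ} {L M : ℕ} {hML : M < L}

/-- Each coefficient `p^L`, `p^{(m+1)(L-M)}`, `p^M` of `coordD` has a positive exponent; the witness
lowers it by one. -/
lemma exists_smul_coordD_eq (hM : 1 ≤ M) (hML : M < L) {n n' : ℤ} (h : n' + 1 = n) {x : EForms R A}
    (hx : x ∈ C R A n) : ∃ y ∈ C R A n', (p : R) • y = coordD R A p L M x := by
  subst h
  have hp {N : ℕ} (hN : 1 ≤ N) (y : Forms R A) :
      (p : R) • (p : R) ^ (N - 1) • y = (p : R) ^ N • y := by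
    rw [smul_smul, ← pow_succ', Nat.sub_add_cancel hN]
  refine ⟨(fun m => -((p : R) ^ (L - 1) • Forms.d R A (x.1 (m + 1))),
    fun m => (p : R) ^ ((m + 1) * (L - M) - 1) • x.1 m +
      (p : R) ^ (M - 1) • Forms.d R A (x.2 (m + 1))), fun m => ⟨?_, ?_⟩, ?_⟩
  · exact neg_mem (Submodule.smul_mem _ _ (d_mem_Om R A (by push_cast; ring) (hx (m + 1)).1))
  · have h2 := (hx m).1
    rw [show n' + 1 - 2 * (m : ℤ) - 1 = n' - 2 * m by ring] at h2
    exact add_mem (Submodule.smul_mem _ _ h2)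
      (Submodule.smul_mem _ _ (d_mem_Om R A (by push_cast; ring) (hx (m + 1)).2))
  · ext m
    · simp only [coordD, LinearMap.coe_mk, AddHom.coe_mk, Prod.smul_fst, Pi.smul_apply, smul_neg]
      rw [hp (by omega)]
    · simp only [coordD, LinearMap.coe_mk, AddHom.coe_mk, Prod.smul_snd, Pi.smul_apply, smul_add]
      rw [hp (Nat.mul_pos (by omega) (by omega)), hp hM]

lemma exists_smul_coordCx_d_eq (hM : 1 ≤ M) {i j : ℤ} (hij : i + 1 = j)
    (x : (coordCx R A p hML).X i) :
    ∃ y : (coordCx R A p hML).X j, (p : R) • y = (coordCx R A p hML).d i j x := by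
  obtain ⟨y, hy, h⟩ := exists_smul_coordD_eq (p := p) hM hML (n := -i) (n' := -j) (by omega)
    (Subtype.prop (p := (· ∈ C R A (-i))) x)
  refine ⟨(⟨y, hy⟩ : C R A (-j)), ?_⟩
  refine Eq.trans (Subtype.ext ?_) (coordCx_d hij x).symm
  exact h

lemma modP_d_coordPsi (hM : 1 ≤ M) {i j : ℤ} (hij : i + 1 = j) (x : (coordCx R A p hML).X i) :
    (modP p (relCC R A p hML)).d i j (toModP p ((coordPsi R A p hML).f i x)) = 0 := by
  obtain ⟨y, hy⟩ := exists_smul_coordCx_d_eq hM hij x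
  rw [modP_d, ← coordPsi_d, ← hy, map_smul, toModP_smul_self]

/-- If `𝐝z = p z'`, decomposing both sides and comparing complementary parts shows that the `k` of
`z` is divisible by `p`. -/
lemma exists_coordPsi_add_of_modP_d_eq_zero {i j l : ℤ} (hij : i + 1 = j)
    (hjl : j + 1 = l) {z : (modP p (relCC R A p hML)).X j}
    (hz : (modP p (relCC R A p hML)).d j l z = 0) :
    ∃ (x : (coordCx R A p hML).X j) (w : (modP p (relCC R A p hML)).X i),
      z = toModP p ((coordPsi R A p hML).f j x) + (modP p (relCC R A p hML)).d i j w := by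
  obtain ⟨z, rfl⟩ := toModP_surjective z
  rw [modP_d, toModP_eq_zero_iff] at hz
  obtain ⟨z', hz'⟩ := hz
  obtain ⟨x, k, k', hk, hk', rfl⟩ := exists_decomposition hij z
  obtain ⟨x₁, k₁, k₁', hk₁, hk₁', rfl⟩ := exists_decomposition hjl z'
  rw [map_add, map_add, d_d_apply, add_zero, ← coordPsi_d] at hz'
  obtain ⟨-, -, h⟩ := decomposition_unique hjl
    (x := (p : R) • x₁ - (coordCx R A p hML).d j l x) (k := (p : R) • k₁)
    (k' := (p : R) • k₁' - k) (Submodule.smul_mem (Compl R A) _ hk₁)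
    (sub_mem (Submodule.smul_mem (Compl R A) _ hk₁') hk) (by
      rw [map_sub, map_sub, map_smul, map_smul, ← sub_eq_zero.mpr hz']
      simp only [smul_add]
      abel)
  refine ⟨x, toModP p k', ?_⟩
  rw [modP_d, ← toModP_add, toModP_eq_iff]
  refine ⟨k₁', ?_⟩
  rw [sub_eq_zero.mp h]
  abel

/-- Comparing the `Ψ`-parts of `𝐝w = Ψ(x) + p u` gives `x + p x₂ = d x₁`, and `d x₁` is itself
divisible by `p`. -/
lemma exists_modP_d_eq_coordPsi_iff (hM : 1 ≤ M) {i j : ℤ} (hij : i + 1 = j)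
    (x : (coordCx R A p hML).X j) :
    (∃ w, (modP p (relCC R A p hML)).d i j w = toModP p ((coordPsi R A p hML).f j x)) ↔
      ∃ y, (p : R) • y = x := by
  constructor
  · rintro ⟨w, hw⟩
    obtain ⟨w, rfl⟩ := toModP_surjective w
    rw [modP_d, toModP_eq_iff] at hw
    obtain ⟨u, hu⟩ := hw
    obtain ⟨x₁, k, k', hk, hk', rfl⟩ := exists_decomposition (i := i - 1) (by ring) w
    obtain ⟨x₂, k₂, k₂', hk₂, hk₂', rfl⟩ := exists_decomposition hij u
    rw [map_add, map_add, d_d_apply, add_zero, ← coordPsi_d] at hu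
    obtain ⟨h, -, -⟩ := decomposition_unique hij
      (x := x + (p : R) • x₂ - (coordCx R A p hML).d i j x₁) (k := (p : R) • k₂)
      (k' := (p : R) • k₂' - k) (Submodule.smul_mem (Compl R A) _ hk₂)
      (sub_mem (Submodule.smul_mem (Compl R A) _ hk₂') hk) (by
        rw [map_sub, map_sub, map_add, map_smul, map_smul, ← sub_eq_zero.mpr hu.symm]
        simp only [smul_add]
        abel)
    obtain ⟨y, hy⟩ := exists_smul_coordCx_d_eq hM hij x₁
    refine ⟨y - x₂, ?_⟩
    rw [smul_sub, hy, ← sub_eq_zero.mp h]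
    abel
  · rintro ⟨y, rfl⟩
    refine ⟨0, ?_⟩
    rw [map_zero, map_smul, toModP_smul_self]

/-- Apart from the `ε`-terms in the summand `0`, all terms of `Ψ` carry `p^{iL}`, `p^{iM}` with `i ≥
1`, or `p^{(i+1)M}`. -/
lemma toModP_coordPsi_eq (hM : 1 ≤ M) (hML : M < L) {i : ℤ} {x : EForms R A} (hx : x ∈ C R A (-i))
    {z : (relCC R A p hML).X i}
    (hz : toPair z = ((Pi.single 0 (fun m => (-1 : R) ^ m • x.1 m, 0) : ℕ → EForms R A),
      (Pi.single 0 (fun m => (-1 : R) ^ m • x.2 m, 0) : ℕ → EForms R A))) :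
    toModP p z = toModP p ((coordPsi R A p hML).f i (⟨x, hx⟩ : C R A (-i))) := by
  have hp {N : ℕ} (hN : N ≠ 0) (y : Forms R A) :
      (p : R) • (p : R) ^ (N - 1) • y = (p : R) ^ N • y := by
    rw [smul_smul, ← pow_succ', Nat.sub_add_cancel (Nat.pos_of_ne_zero hN)]
  -- `u` is `(Ψ(x) - z) / p`. The case `i = 0` is set to zero separately, because there the exponent
  -- `i * L - 1` would be truncated.
  set u : (ℕ → EForms R A) × (ℕ → EForms R A) :=
    (fun i => (fun m => if i = 0 then 0 else (-1 : R) ^ m • (p : R) ^ (i * L - 1) • x.1 (i + m),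
      fun m => if m = 0 then (p : R) ^ ((i + 1) * M - 1) • x.2 i else 0),
    fun i => (fun m => if i = 0 then 0 else (-1 : R) ^ m • (p : R) ^ (i * M - 1) • x.2 (i + m), 0))
    with hu
  have hu1 : u.1 ∈ CC R A (-i) := by
    intro a m
    constructor
    · simp only [hu]
      split_ifs with ha
      · exact zero_mem _
      · refine Submodule.smul_mem _ _ (Submodule.smul_mem _ _ ?_)
        convert (hx (a + m)).1 using 1
        push_cast; ring_nf
    · simp only [hu]
      split_ifs with hm
      · subst hm
        refine Submodule.smul_mem _ _ ?_
        convert (hx a).2 using 1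
        push_cast; ring_nf
      · exact zero_mem _
  have hu2 : u.2 ∈ CC R A (-i + 1) := by
    intro a m
    refine ⟨?_, zero_mem _⟩
    simp only [hu]
    split_ifs with ha
    · exact zero_mem _
    · refine Submodule.smul_mem _ _ (Submodule.smul_mem _ _ ?_)
      convert (hx (a + m)).2 using 1
      push_cast; ring_nf
  obtain ⟨w, hw⟩ := exists_toPair (p := p) (hML := hML) rfl hu1 hu2
  symm
  rw [toModP_eq_iff]
  refine ⟨w, toPair_injective ?_⟩
  rw [toPair_add, toPair_smul, toPair_coordPsi, hz, hw]
  refine Prod.ext (funext fun a => Prod.ext (funext fun m => ?_) (funext fun m => ?_))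
    (funext fun a => Prod.ext (funext fun m => ?_) ?_)
  · by_cases ha : a = 0
    · subst ha; simp [coordFst, hu]
    · simp only [coordFst, hu, LinearMap.coe_mk, AddHom.coe_mk, Prod.fst_add, Prod.smul_fst,
        Pi.add_apply, Pi.smul_apply, Pi.single_eq_of_ne ha, zero_add,
        if_neg ha]
      rw [smul_comm (p : R), hp (mul_ne_zero ha (by omega)), smul_smul]
  · by_cases hm : m = 0
    · subst hm
      have h0 : ((Pi.single 0 (fun m => (-1 : R) ^ m • x.1 m, 0) : ℕ → EForms R A) a).2 0 = 0 := by
        by_cases ha : a = 0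
        · subst ha; simp
        · simp [ha]
      simp only [coordFst, hu, LinearMap.coe_mk, AddHom.coe_mk, Prod.fst_add, Prod.snd_add,
        Prod.smul_fst, Prod.smul_snd, Pi.add_apply, Pi.smul_apply, h0, zero_add, if_true]
      rw [hp (mul_ne_zero (by omega) (by omega))]
    · by_cases ha : a = 0
      · subst ha; simp [coordFst, hu, hm]
      · simp [coordFst, hu, hm, ha]
  · by_cases ha : a = 0
    · subst ha; simp [coordSnd, hu]
    · simp only [coordSnd, hu, LinearMap.coe_mk, AddHom.coe_mk, Prod.snd_add,
        Prod.smul_fst, Prod.smul_snd,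
        Pi.add_apply, Pi.smul_apply, Pi.single_eq_of_ne ha, zero_add,
        if_neg ha]
      rw [smul_comm (p : R), hp (mul_ne_zero ha (by omega)), smul_smul]
  · by_cases ha : a = 0
    · subst ha; simp [coordSnd, hu]
    · simp [coordSnd, hu, ha]

lemma mem_Om_natCast {s : ℕ} {t : ℤ} (h : t = s) {x : Forms R A} :
    x ∈ Om R A t ↔ x ∈ ⋀[A]^s (Ω[A⁄R]) := by
  subst h
  rw [Om, if_pos (by omega), Int.toNat_natCast, Submodule.restrictScalars_mem]

variable (R A) in
/-- The coordinate of degree `s` of an element of total degree `n`, up to sign. -/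
noncomputable def coordForm (n s : ℕ) : EForms R A →ₗ[R] Forms R A :=
  (-1 : R) ^ ((n - s) / 2) •
    if Even (n - s) then (LinearMap.proj ((n - s) / 2)).comp (LinearMap.snd R _ _)
    else (LinearMap.proj ((n - s) / 2)).comp (LinearMap.fst R _ _)

lemma coordForm_even {n s m : ℕ} (h : s + 2 * m = n) (x : EForms R A) :
    coordForm R A n s x = (-1 : R) ^ m • x.2 m := by
  have h1 : n - s = 2 * m := by omega
  rw [coordForm, h1, if_pos (even_two_mul m), Nat.mul_div_cancel_left m two_pos]
  rfl

lemma coordForm_odd {n s m : ℕ} (h : s + 2 * m + 1 = n) (x : EForms R A) :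
    coordForm R A n s x = (-1 : R) ^ m • x.1 m := by
  have h1 : n - s = 2 * m + 1 := by omega
  have h2 : (2 * m + 1) / 2 = m := by omega
  rw [coordForm, h1, if_neg (by simp), h2]
  rfl

lemma coordForm_mem {n s : ℕ} (hs : s ≤ n) {t : ℤ} (ht : t = n) {x : EForms R A}
    (hx : x ∈ C R A t) : coordForm R A n s x ∈ ⋀[A]^s (Ω[A⁄R]) := by
  subst ht
  rw [← mem_Om_natCast (t := s) rfl]
  obtain ⟨m, hm | hm⟩ : ∃ m, s + 2 * m = n ∨ s + 2 * m + 1 = n := ⟨(n - s) / 2, by omega⟩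
  · rw [coordForm_even hm]
    have := (hx m).2
    rw [show (n : ℤ) - 2 * m = s by omega] at this
    exact Submodule.smul_mem _ _ this
  · rw [coordForm_odd hm]
    have := (hx m).1
    rw [show (n : ℤ) - 2 * m - 1 = s by omega] at this
    exact Submodule.smul_mem _ _ this

lemma neg_one_pow_smul_self {V : Type*} [AddCommGroup V] [Module R V] (m : ℕ) (v : V) :
    (-1 : R) ^ m • (-1 : R) ^ m • v = v := by
  rw [smul_smul, ← mul_pow]; simp

/-- Each nonzero coordinate of `x` is, up to sign, `coordForm` for exactly one `s ≤ n`: the parity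
of `n - s` selects the family and `(n - s) / 2` the index. -/
lemma exists_smul_eq_of_coordForm {n : ℕ} {t : ℤ} (ht : t = n) {x : EForms R A} (hx : x ∈ C R A t)
    (h : ∀ s ≤ n, ∃ y ∈ ⋀[A]^s (Ω[A⁄R]), (p : R) • y = coordForm R A n s x) :
    ∃ y ∈ C R A t, (p : R) • y = x := by
  subst ht
  have h1 (m : ℕ) : ∃ y ∈ Om R A ((n : ℤ) - 2 * m - 1), (p : R) • y = x.1 m := by
    by_cases hs : (n : ℤ) - 2 * m - 1 < 0
    · exact ⟨0, zero_mem _, by rw [smul_zero, mem_Om_neg hs (hx m).1]⟩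
    · obtain ⟨y, hy, hy'⟩ := h (n - 2 * m - 1) (by omega)
      rw [coordForm_odd (m := m) (by omega)] at hy'
      rw [← mem_Om_natCast (t := (n : ℤ) - 2 * m - 1) (by omega)] at hy
      exact ⟨(-1 : R) ^ m • y, Submodule.smul_mem _ _ hy,
        by rw [smul_comm, hy', neg_one_pow_smul_self]⟩
  have h2 (m : ℕ) : ∃ y ∈ Om R A ((n : ℤ) - 2 * m), (p : R) • y = x.2 m := by
    by_cases hs : (n : ℤ) - 2 * m < 0
    · exact ⟨0, zero_mem _, by rw [smul_zero, mem_Om_neg hs (hx m).2]⟩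
    · obtain ⟨y, hy, hy'⟩ := h (n - 2 * m) (by omega)
      rw [coordForm_even (m := m) (by omega)] at hy'
      rw [← mem_Om_natCast (t := (n : ℤ) - 2 * m) (by omega)] at hy
      exact ⟨(-1 : R) ^ m • y, Submodule.smul_mem _ _ hy,
        by rw [smul_comm, hy', neg_one_pow_smul_self]⟩
  choose y1 hy1 hy1' using h1
  choose y2 hy2 hy2' using h2
  exact ⟨(y1, y2), fun m => ⟨hy1 m, hy2 m⟩, Prod.ext (funext hy1') (funext hy2')⟩

lemma single_fst_mem {t : ℤ} {m : ℕ} {α : Forms R A} (hα : α ∈ Om R A (t - 2 * m - 1)) :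
    ((Pi.single m α, 0) : EForms R A) ∈ C R A t := by
  refine fun m' => ⟨?_, zero_mem _⟩
  by_cases h : m' = m
  · subst h; simpa using hα
  · simp [h]

lemma single_snd_mem {t : ℤ} {m : ℕ} {α : Forms R A} (hα : α ∈ Om R A (t - 2 * m)) :
    ((0, Pi.single m α) : EForms R A) ∈ C R A t := by
  refine fun m' => ⟨zero_mem _, ?_⟩
  by_cases h : m' = m
  · subst h; simpa using hα
  · simp [h]

lemma coordForm_single_fst {n s m : ℕ} (h : s + 2 * m + 1 = n) (s' : ℕ) (hs' : s' ≤ n)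
    (α : Forms R A) : coordForm R A n s' (Pi.single m ((-1 : R) ^ m • α), 0) =
      if s' = s then α else 0 := by
  obtain ⟨m', hm | hm⟩ : ∃ m, s' + 2 * m = n ∨ s' + 2 * m + 1 = n := ⟨(n - s') / 2, by omega⟩
  · rw [coordForm_even hm, if_neg (by omega)]
    simp
  · rw [coordForm_odd hm]
    dsimp only
    by_cases hs : s' = s
    · obtain rfl : m' = m := by omega
      rw [if_pos hs, Pi.single_eq_same, neg_one_pow_smul_self]
    · rw [if_neg hs, Pi.single_eq_of_ne (by omega), smul_zero]

lemma coordForm_single_snd {n s m : ℕ} (h : s + 2 * m = n) (s' : ℕ) (hs' : s' ≤ n)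
    (α : Forms R A) : coordForm R A n s' (0, Pi.single m ((-1 : R) ^ m • α)) =
      if s' = s then α else 0 := by
  obtain ⟨m', hm | hm⟩ : ∃ m, s' + 2 * m = n ∨ s' + 2 * m + 1 = n := ⟨(n - s') / 2, by omega⟩
  · rw [coordForm_even hm]
    dsimp only
    by_cases hs : s' = s
    · obtain rfl : m' = m := by omega
      rw [if_pos hs, Pi.single_eq_same, neg_one_pow_smul_self]
    · rw [if_neg hs, Pi.single_eq_of_ne (by omega), smul_zero]
  · rw [coordForm_odd hm, if_neg (by omega)]
    simp

/-- The homology of `𝐂𝐂(A_L, A_M)` modulo `p`, in terms of any reduction modulo `p` of the modules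
of differential forms. -/
lemma exists_modP_homology_equiv (hM : 1 ≤ M) (hML : M < L) {D : ℕ → Type*}
    [∀ s, AddCommMonoid (D s)] (ρ : ∀ s : ℕ, ⋀[A]^s (Ω[A⁄R]) →+ D s)
    (hρ : ∀ s, Function.Surjective (ρ s))
    (hker : ∀ s (x : ⋀[A]^s (Ω[A⁄R])),
      ρ s x = 0 ↔ ∃ y ∈ ⋀[A]^s (Ω[A⁄R]), (p : R) • y = (x : Forms R A))
    (n : ℕ) :
    ∃ e : (⨁ s : Fin (n + 1), D s) ≃+ (modP p (relCC R A p hML)).homology (-(n : ℤ)),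
      ∀ (s : Fin (n + 1)) (m : ℕ) (α : ⋀[A]^(s : ℕ) (Ω[A⁄R]))
        (z : (relCC R A p hML).X (-(n : ℤ))),
        ((s : ℕ) + 2 * m + 1 = n ∧ toPair z = (epsTerm R A 0 m α, 0) ∨
          (s : ℕ) + 2 * m = n ∧ toPair z = (0, epsTerm R A 0 m α)) →
        Represents (toModP p z) (e (DirectSum.of (fun s : Fin (n + 1) => D s) s (ρ s α))) := by
  have hn : -(-(n : ℤ)) = n := neg_neg _
  let g : C R A (-(-(n : ℤ))) →ₗ[R] (modP p (relCC R A p hML)).X (-(n : ℤ)) :=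
    (Submodule.mkQ _).comp ((coordPsi R A p hML).f (-(n : ℤ))).hom
  obtain ⟨f, hf, hr, hk⟩ := exists_linearMap_represents (K := modP p (relCC R A p hML))
    (i := -(n : ℤ) - 1) (j := -n) (l := -n + 1) (by ring) rfl g
    (fun x => modP_d_coordPsi hM rfl x)
    (fun z hz => exists_coordPsi_add_of_modP_d_eq_zero (by ring) rfl hz)
  -- `π` reduces all coordinates at once. The signs in `coordForm` are those of the leading terms of
  -- `Ψ`, so that the class of `α ε(dε)^m` goes to `ρ α` without sign.
  let π : C R A (-(-(n : ℤ))) →+ ⨁ s : Fin (n + 1), D s :=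
    { toFun := fun x => DFinsupp.equivFunOnFintype.symm fun s =>
        ρ s ⟨coordForm R A n s x, coordForm_mem (by omega) hn x.2⟩
      map_zero' := DFinsupp.ext fun s => by
        have : (⟨coordForm R A n s (0 : C R A (-(-(n : ℤ)))),
          coordForm_mem (by omega) hn (zero_mem _)⟩ : ⋀[A]^(s : ℕ) (Ω[A⁄R])) = 0 :=
          Subtype.ext (map_zero _)
        exact (congrArg (ρ s) this).trans (map_zero _)
      map_add' := fun x y => DFinsupp.ext fun s => by
        have : (⟨coordForm R A n s (x + y : C R A (-(-(n : ℤ)))),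
          coordForm_mem (by omega) hn (x + y).2⟩ : ⋀[A]^(s : ℕ) (Ω[A⁄R])) =
          ⟨coordForm R A n s x, coordForm_mem (by omega) hn x.2⟩ +
          ⟨coordForm R A n s y, coordForm_mem (by omega) hn y.2⟩ :=
          Subtype.ext (map_add _ _ _)
        exact (congrArg (ρ s) this).trans (map_add _ _ _) }
  have hπ (x) (s : Fin (n + 1)) : π x s =
    ρ s ⟨coordForm R A n s x, coordForm_mem (by omega) hn x.2⟩ := rfl
  have hof (s : Fin (n + 1)) (α : ⋀[A]^(s : ℕ) (Ω[A⁄R])) (x : C R A (-(-(n : ℤ))))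
      (hx : ∀ s' ≤ n, coordForm R A n s' x = if s' = s then (α : Forms R A) else 0) :
      π x = DirectSum.of (fun s : Fin (n + 1) => D s) s (ρ s α) := by
    refine DFinsupp.ext fun s' => ?_
    rw [hπ]
    have h' := hx s' (by omega)
    by_cases hs : s' = s
    · subst hs
      rw [DirectSum.of_eq_same]
      rw [if_pos rfl] at h'
      exact congrArg (ρ s') (Subtype.ext h')
    · rw [DirectSum.of_eq_of_ne _ _ _ hs]
      rw [if_neg (by rwa [Fin.val_inj])] at h'
      exact (congrArg (ρ s') (Subtype.ext h' : _ = (0 : ⋀[A]^(s' : ℕ) (Ω[A⁄R])))).trans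
        (map_zero _)
  -- an element with a prescribed coordinate
  have hrep (s : Fin (n + 1)) (m : ℕ) (α : ⋀[A]^(s : ℕ) (Ω[A⁄R]))
      (h : (s : ℕ) + 2 * m + 1 = n ∨ (s : ℕ) + 2 * m = n) :
      ∃ x : C R A (-(-(n : ℤ))), π x = DirectSum.of (fun s : Fin (n + 1) => D s) s (ρ s α) ∧
        ((s : ℕ) + 2 * m + 1 = n → x.1 = (Pi.single m ((-1 : R) ^ m • (α : Forms R A)), 0)) ∧
        ((s : ℕ) + 2 * m = n → x.1 = (0, Pi.single m ((-1 : R) ^ m • (α : Forms R A)))) := by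
    rcases h with h | h
    · refine ⟨⟨_, single_fst_mem (Submodule.smul_mem _ ((-1 : R) ^ m)
        ((mem_Om_natCast (s := s) (by omega)).mpr α.2))⟩, hof s α _ fun s' hs' =>
          coordForm_single_fst h s' hs' _, fun _ => rfl, fun h' => by omega⟩
    · refine ⟨⟨_, single_snd_mem (Submodule.smul_mem _ ((-1 : R) ^ m)
        ((mem_Om_natCast (s := s) (by omega)).mpr α.2))⟩, hof s α _ fun s' hs' =>
          coordForm_single_snd h s' hs' _, fun h' => by omega, fun _ => rfl⟩
  have hπs : Function.Surjective π := by
    rw [← AddMonoidHom.mrange_eq_top, eq_top_iff]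
    rintro y -
    induction y using DirectSum.induction_on with
    | zero => exact zero_mem _
    | add a b ha hb => exact add_mem ha hb
    | of s c =>
      obtain ⟨α, rfl⟩ := hρ s c
      obtain ⟨x, hx, -⟩ := hrep s ((n - s) / 2) α (by omega)
      exact ⟨x, hx⟩
  -- Both kernels are the multiples of `p` in `𝐂_n`.
  have hfπ (x) : f x = 0 ↔ π x = 0 := by
    refine (hk x).trans ((exists_modP_d_eq_coordPsi_iff hM (by ring) _).trans ?_)
    constructor
    · rintro ⟨y, rfl⟩
      refine DFinsupp.ext fun s => ?_
      let y' : C R A (-(-(n : ℤ))) := y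
      refine (hker s _).mpr ⟨coordForm R A n s y', coordForm_mem (by omega) hn y'.2, ?_⟩
      exact (map_smul _ _ _).symm
    · intro h
      obtain ⟨y, hy, hyx⟩ := exists_smul_eq_of_coordForm (p := p) hn x.2 fun s hs => by
        have := congrFun (congrArg DFunLike.coe h) (⟨s, by omega⟩ : Fin (n + 1))
        exact (hker s _).mp this
      exact ⟨(⟨y, hy⟩ : C R A (-(-(n : ℤ)))), Subtype.ext hyx⟩
  obtain ⟨e, he⟩ := @exists_addEquiv_of_ker_eq (C R A (-(-(n : ℤ))))
    ((modP p (relCC R A p hML)).homology (-(n : ℤ))) (⨁ s : Fin (n + 1), D s) _ _ _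
    f.toAddMonoidHom π hf hπs hfπ
  refine ⟨e, fun s m α z hz => ?_⟩
  obtain ⟨x, hx, h1, h2⟩ := hrep s m α (hz.imp And.left And.left)
  rw [← hx, he]
  have hz' : toModP p z = g x := by
    refine toModP_coordPsi_eq hM hML x.2 ?_
    have hsig (m' : ℕ) : (-1 : R) ^ m' • (Pi.single m ((-1 : R) ^ m • (α : Forms R A)) :
        ℕ → Forms R A) m' = (Pi.single m (α : Forms R A) : ℕ → Forms R A) m' := by
      by_cases hm : m' = m
      · subst hm
        rw [Pi.single_eq_same, Pi.single_eq_same, neg_one_pow_smul_self]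
      · rw [Pi.single_eq_of_ne hm, Pi.single_eq_of_ne hm, smul_zero]
    rcases hz with ⟨h, hz⟩ | ⟨h, hz⟩
    · rw [hz, h1 h]
      simp only [hsig, Pi.zero_apply, smul_zero]
      exact Prod.ext rfl (Pi.single_zero 0).symm
    · rw [hz, h2 h]
      simp only [hsig, Pi.zero_apply, smul_zero]
      exact Prod.ext (Pi.single_zero 0).symm rfl
  rw [hz']
  exact hr x

end ModP

/-! ### Reduction of forms to the special fibre. -/

section FibreReduction

lemma exists_forms_reduction {R A k A₁ : Type*} [CommRing R] [CommRing A] [CommRing k]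
    [CommRing A₁] [Algebra R A] [Algebra k A₁] [Algebra A A₁] [Algebra R k] [Algebra R A₁]
    [IsScalarTower R A A₁] [IsScalarTower R k A₁] [SMulCommClass k A A₁] {c : R}
    (hA : Function.Surjective (algebraMap A A₁)) (hk : Function.Surjective (algebraMap R k))
    (hc : RingHom.ker (algebraMap A A₁) = Ideal.span {algebraMap R A c}) :
    ∃ ρ : ∀ s : ℕ, ⋀[A]^s (Ω[A⁄R]) →+ ⋀[A₁]^s (Ω[A₁⁄k]), (∀ s, Function.Surjective (ρ s)) ∧
      (∀ s x, ρ s x = 0 ↔ ∃ y ∈ ⋀[A]^s (Ω[A⁄R]), c • y = (x : Forms R A)) ∧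
      ∀ s (a : A) (b : Fin s → A),
        ρ s (a • exteriorPower.ιMulti A s fun i => KaehlerDifferential.D R A (b i)) =
          algebraMap A A₁ a • exteriorPower.ιMulti A₁ s
            fun i => KaehlerDifferential.D k A₁ (algebraMap A A₁ (b i)) := by
  refine ⟨fun s => AddMonoidHom.mk' (fun x => ⟨formsMap R A k A₁ x, formsMap_mem R A k A₁ x.2⟩)
    fun x y => Subtype.ext (map_add _ _ _), fun s y => ?_, fun s x => ?_, fun s a b => ?_⟩
  · obtain ⟨x, hx, hxy⟩ := formsMap_surjOn (R := R) (k := k) hA y.2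
    exact ⟨⟨x, hx⟩, Subtype.ext hxy⟩
  · constructor
    · intro h
      exact exists_smul_of_formsMap_eq_zero hA hk hc x.2 (congrArg Subtype.val h)
    · rintro ⟨y, hy, hyx⟩
      refine Subtype.ext ?_
      have h0 : algebraMap A A₁ (algebraMap R A c) = 0 := by
        rw [← RingHom.mem_ker, hc]
        exact Ideal.mem_span_singleton_self _
      change formsMap R A k A₁ x = 0
      rw [← hyx, ← algebraMap_smul A c, formsMap_smul, h0, zero_smul]
  · exact Subtype.ext (formsMap_smul_ιMulti a b)

variable (p : ℕ) [Fact p.Prime] (k : Type*) [Field k] [CharP k p] [PerfectRing k p]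
  (A : Type*) [CommRing A] [Algebra (WittVector p k) A]

lemma exists_specialFibre_reduction :
    ∃ ρ : ∀ s : ℕ, ⋀[A]^s (Ω[A⁄WittVector p k]) →+ ⋀[SpecialFibre p A]^s (Ω[SpecialFibre p A⁄k]),
      (∀ s, Function.Surjective (ρ s)) ∧
      (∀ s x, ρ s x = 0 ↔ ∃ y ∈ ⋀[A]^s (Ω[A⁄WittVector p k]),
        (p : WittVector p k) • y = (x : Forms (WittVector p k) A)) ∧
      ∀ s (a : A) (b : Fin s → A),
        ρ s (a • exteriorPower.ιMulti A s
            fun i => KaehlerDifferential.D (WittVector p k) A (b i)) =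
          toFibre p A a • exteriorPower.ιMulti (SpecialFibre p A) s
            fun i => KaehlerDifferential.D k (SpecialFibre p A) (toFibre p A (b i)) := by
  let : Algebra A (SpecialFibre p A) := (toFibre p A).toAlgebra
  -- The `k`-structure on `A_1` was defined through `W(k)/p ≅ k`; `fibreMap_constantCoeff` makes it
  -- compatible with `W(k) → k`.
  let : Algebra (WittVector p k) k := WittVector.constantCoeff.toAlgebra
  let : Algebra (WittVector p k) (SpecialFibre p A) :=
    ((toFibre p A).comp (algebraMap (WittVector p k) A)).toAlgebra
  have : IsScalarTower (WittVector p k) A (SpecialFibre p A) :=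
    IsScalarTower.of_algebraMap_eq fun _ => rfl
  have : IsScalarTower (WittVector p k) k (SpecialFibre p A) :=
    IsScalarTower.of_algebraMap_eq fun w => (fibreMap_constantCoeff p A k w).symm
  have : SMulCommClass k A (SpecialFibre p A) := ⟨fun x a y => by
    rw [Algebra.smul_def, Algebra.smul_def, Algebra.smul_def, Algebra.smul_def, mul_left_comm]⟩
  refine exists_forms_reduction (c := (p : WittVector p k)) Ideal.Quotient.mk_surjective
    (WittVector.constantCoeff_surjective p) ?_
  rw [map_natCast]
  exact Ideal.mk_ker

end FibreReduction
end RelCyclic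

theorem mainTheorem5 (p : ℕ) [Fact p.Prime]
    (k : Type*) [Field k] [CharP k p] [PerfectRing k p]
    (A : Type*) [CommRing A] [Algebra (WittVector p k) A] [Algebra.Smooth (WittVector p k) A]
    (L M : ℕ) (hM : 1 ≤ M) (hML : M < L) :
    -- the formula for `Ψ` defines a unique morphism of complexes
    (∃! Ψ : source (WittVector p k) A p hML ⟶ relCC (WittVector p k) A p hML, IsPsi Ψ) ∧
    (∀ Ψ : source (WittVector p k) A p hML ⟶ relCC (WittVector p k) A p hML, IsPsi Ψ →
      -- it is a quasi-isomorphism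
      QuasiIso Ψ ∧
      -- and induces the description of `𝐇𝐂_n(A_L, A_M)`
      ∀ n : ℕ, ∃ e : (⨁ j : ℕ, HCSummand (WittVector p k) A p L M n j) ≃ₗ[WittVector p k]
          HC (WittVector p k) A p hML n,
        ∀ r j : ℕ, r + j = n → ∀ (ω : hcNum (WittVector p k) A p L M n j)
          (c : ConeX (WittVector p k) A p L M r (-(n : ℤ) + 2 * r)),
          (c.1 : Forms (WittVector p k) A) = -dTr (WittVector p k) A r ((n : ℤ) - 2 * j) ω →
          (c.2 : Forms (WittVector p k) A) = ω →
          Represents (Ψ.f _ (inCone hML r _ c))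
            (e (DirectSum.lof (WittVector p k) ℕ
              (fun j => HCSummand (WittVector p k) A p L M n j) j
              (Submodule.Quotient.mk ω)))) ∧
    -- the homology modulo `p`
    (∀ n : ℕ, ∃ e : (⨁ s : Fin (n + 1), ⋀[SpecialFibre p A]^(s : ℕ) (Ω[SpecialFibre p A⁄k])) ≃+
        (modP p (relCC (WittVector p k) A p hML)).homology (-(n : ℤ)),
      ∀ (s : Fin (n + 1)) (m : ℕ) (a : A) (b : Fin (s : ℕ) → A)
        (z : (relCC (WittVector p k) A p hML).X (-(n : ℤ))),
        ((s : ℕ) + 2 * m + 1 = n ∧ toPair z = (epsTerm (WittVector p k) A 0 m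
            (a • ExteriorAlgebra.ιMulti A (s : ℕ)
              fun i => KaehlerDifferential.D (WittVector p k) A (b i)), 0) ∨
          (s : ℕ) + 2 * m = n ∧ toPair z = (0, epsTerm (WittVector p k) A 0 m
            (a • ExteriorAlgebra.ιMulti A (s : ℕ)
              fun i => KaehlerDifferential.D (WittVector p k) A (b i)))) →
        Represents (toModP p z)
          (e (DirectSum.of
            (fun s : Fin (n + 1) => ⋀[SpecialFibre p A]^(s : ℕ) (Ω[SpecialFibre p A⁄k])) s
            (toFibre p A a • exteriorPower.ιMulti (SpecialFibre p A) (s : ℕ)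
              fun i => KaehlerDifferential.D k (SpecialFibre p A) (toFibre p A (b i)))))) := by
  have htf := forms_torsionFree p k A
  refine ⟨existsUnique_isPsi htf, fun Ψ hΨ => ⟨hΨ.quasiIso htf, hΨ.exists_homology_equiv htf⟩,
    fun n => ?_⟩
  obtain ⟨ρ, hρ, hker, hι⟩ := exists_specialFibre_reduction p k A
  obtain ⟨e, he⟩ := exists_modP_homology_equiv hM hML ρ hρ hker n
  refine ⟨e, fun s m a b z hz => ?_⟩
  rw [← hι]
  exact he s m _ z hz
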